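/- Let $\lambda$ be a cardinal and let $\theta_1,\theta_2\le\lambda$ be regular (infinite) cardinals with $\theta_1+\theta_2>\aleph_0$. For a partial order $P$, a $(\kappa_1,\kappa_2)$-pre-cut of $P$ is a pair $(C_1,C_2)$ of subsets of $P$ such that $C_1\cup C_2$ is linearly ordered, $a_1\le a_2$ for all $a_1\in C_1$, $a_2\in C_2$, there is no $c\in P$ with $a_1\le c\le a_2$ for all $a_1\in C_1$, $a_2\in C_2$, the cofinality of $C_1$ is $\kappa_1$, and the cofinality of $C_2$ with the inverse order is $\kappa_2$. For a strict order $(X,<)$ let $\mathfrak t(X,<)$ be the least cardinal $\kappa\ge\aleph_0$ such that some $<$-increasing sequence of length $\kappa$ in $X$ has no $<$-upper bound. A proper filter $D$ on $\lambda$ is regular if there are finite sets $u_i\subseteq\lambda$ $(i<\lambda)$ with $\{i<\lambda:\alpha\in u_i\}\in D$ for every $\alpha<\lambda$. In a reduced power modulo $D$, a relation holds between $f/D$ and $g/D$ iff it holds between $f(i)$ and $g(i)$ for all $i$ in some member of $D$. Then there is a regular proper filter $D$ on $\lambda$ such that: (a) for every dense linear order $(M,\le)$ with at least two elements, the reduced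 power $(M,\le)^\lambda/D$ has a $(\theta_1,\theta_2)$-pre-cut, but it has no $(\kappa_1,\kappa_2)$-pre-cut whenever $\kappa_1,\kappa_2\le\lambda$ are regular cardinals with $\{\theta_1,\theta_2\}\not\subseteq\{\kappa_1,\kappa_2\}$; (b) if $\theta_1\ne\theta_2$, then $\mathfrak t\big(({}^{\omega>}2,\triangleleft)^\lambda/D\big)\ge\lambda^+$, where ${}^{\omega>}2$ is the set of finite binary sequences and $\triangleleft$ is the relation of being a proper initial segment; so every increasing sequence in this reduced power whose length is an infinite cardinal $\le\lambda$ has an upper bound. The same holds for the strict part of the partial order $({}^{\omega>}2,\trianglelefteq)^\lambda/D$, where $\trianglelefteq$ is the relation of being an initial segment. -/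

import Mathlib

universe u v

open Cardinal

/-- The filter `D` on `I` is regular, i.e. `(#I, ℵ₀)`-regular: there are finite sets `U i ⊆ I`
such that every `a : I` belongs to `U i` for `D`-almost all `i`. Equivalently, `D` contains a
family of `#I` sets such that each `i : I` lies in only finitely many of them. -/
def IsRegularFilter {I : Type u} (D : Filter I) : Prop :=
  ∃ U : I → Finset I, ∀ a : I, {i | a ∈ U i} ∈ D

/-- `(C₁, C₂)` is a pre-cut of the partial order `P`. -/
structure IsPreCut {P : Type u} [PartialOrder P] (C₁ C₂ : Set P) : Prop where
  chain : IsChain (· ≤ ·) (C₁ ∪ C₂)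
  le : ∀ a₁ ∈ C₁, ∀ a₂ ∈ C₂, a₁ ≤ a₂
  unfilled : ¬ ∃ c : P, (∀ a₁ ∈ C₁, a₁ ≤ c) ∧ ∀ a₂ ∈ C₂, c ≤ a₂

/-- The partial order `P` has a `(κ₁, κ₂)`-pre-cut: a pre-cut `(C₁, C₂)` such that `C₁` has
cofinality `κ₁` and the inverse order of `C₂` has cofinality `κ₂`. -/
def HasPreCut (P : Type u) [PartialOrder P] (κ₁ κ₂ : Cardinal.{u}) : Prop :=
  ∃ C₁ C₂ : Set P, IsPreCut C₁ C₂ ∧ Order.cof C₁ = κ₁ ∧ Order.cof (C₂)ᵒᵈ = κ₂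

/-- For a strict order relation `r` on `X`, the least infinite cardinal `κ` such that there is an
`r`-increasing sequence of length `κ` with no `r`-upper bound. -/
noncomputable def towerNumber {X : Type u} (r : X → X → Prop) : Cardinal.{u} :=
  sInf {κ : Cardinal.{u} | ℵ₀ ≤ κ ∧ ∃ f : κ.ord.ToType → X,
    (∀ α β, α < β → r (f α) (f β)) ∧ ¬ ∃ x, ∀ α, r (f α) x}

/-- `s` is an initial segment of `t`, for finite binary sequences. -/
def BinPrefix (s t : List Bool) : Prop := s <+: t

/-- `s` is a proper initial segment of `t`, for finite binary sequences. -/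
def BinStrictPrefix (s t : List Bool) : Prop := s <+: t ∧ s ≠ t

/-- The strict tree relation of the reduced power of the full binary tree of finite sequences:
`f / D` is below `g / D` iff `f i` is a proper initial segment of `g i` for `D`-almost all `i`. -/
def treeLT {I : Type u} (D : Filter I) (x y : D.Germ (List Bool)) : Prop :=
  Filter.Germ.LiftRel BinStrictPrefix x y

/-- The strict part of the partial order on the reduced power of the full binary tree which is
given by `f i` being an initial segment of `g i` for `D`-almost all `i`. -/
def treePosetLT {I : Type u} (D : Filter I) (x y : D.Germ (List Bool)) : Prop :=
  Filter.Germ.LiftRel BinPrefix x y ∧ x ≠ y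

/-!
By the Engelking–Karłowicz theorem there are `2 ^ |I|` independent functions on `I`. One of them
yields regularity and a generic chain of functions `I → ℚ`, indexed by `Θ₁ + Θ₂ᵒᵈ` where `Θ₁`, `Θ₂`
are well-orders of types `θ₁`, `θ₂`; the others, taken one by one along a well-order, are made
internal bounds of the directed sets which occur in filling a cut or in bounding a branch. The cut
of the chain stays unfilled because, for any `U ξ` and `V ζ` in the filter, the functions which have
not been used yet are independent on a part of some `U ξ ∩ V ζ` where the chain is reversed between
`ξ` and `ζ`. Membership of `U ξ` and of `V ζ` depends on finite supports, which form Δ-systems as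
one of `θ₁`, `θ₂` is uncountable. Two of them meet only in the roots, and the demands of a root can
be met by a common bound, because a map from a regular cardinal to a different regular cardinal is
bounded on a cofinal set.
-/

universe w

open Filter Set Order

section Independence

variable {X Y I J : Type*}

/-- The functions `h x`, for `x ∈ Y`, are independent on `A` if any finitely many of their values
can be prescribed at some point of `A`. -/
def IsIndependentOn (h : X → I → J) (Y : Set X) (A : Set I) : Prop :=
  ∀ s : Finset X, ↑s ⊆ Y → ∀ v : X → J, ∃ i ∈ A, ∀ x ∈ s, h x i = v x

theorem IsIndependentOn.mono {h : X → I → J} {Y : Set X} {A B : Set I}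
    (hA : IsIndependentOn h Y A) (hAB : A ⊆ B) : IsIndependentOn h Y B := fun s hs v =>
  let ⟨i, hi, hv⟩ := hA s hs v
  ⟨i, hAB hi, hv⟩

theorem IsIndependentOn.nonempty [Nonempty J] {h : X → I → J} {Y : Set X} {A : Set I}
    (hA : IsIndependentOn h Y A) : A.Nonempty :=
  let ⟨i, hi, _⟩ := hA ∅ (by simp) fun _ => Classical.arbitrary J
  ⟨i, hi⟩

theorem IsIndependentOn.comp_some {k : Option X → I → J} (hk : IsIndependentOn k univ univ)
    (z : J) : IsIndependentOn (fun x => k (some x)) univ {i | k none i = z} := by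
  intro s _ v
  obtain ⟨i, -, hi⟩ := hk (Finset.insertNone s) (subset_univ _) fun o => o.elim z v
  exact ⟨i, hi none (by simp), fun x hx => hi (some x) (by simpa using hx)⟩

open Classical in
theorem exists_finset_injOn_filter (F : Set (Set I)) (hF : F.Finite) :
    ∃ t : Finset I, InjOn (fun A => {a ∈ t | a ∈ A}) F := by
  have hsep : ∀ P : Set I × Set I, ∃ t : Finset I, P.1 ≠ P.2 → ∃ a ∈ t, ¬(a ∈ P.1 ↔ a ∈ P.2) := by
    rintro ⟨A, B⟩
    by_cases hAB : A = B
    · exact ⟨∅, fun h => absurd hAB h⟩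
    · obtain ⟨a, ha⟩ := not_forall.1 (mt Set.ext hAB)
      exact ⟨{a}, fun _ => ⟨a, Finset.mem_singleton_self a, ha⟩⟩
  choose d hd using hsep
  refine ⟨(hF.prod hF).toFinset.biUnion d, fun A hA B hB hAB => ?_⟩
  by_contra hne
  obtain ⟨a, hat, ha⟩ := hd (A, B) hne
  have hmem : a ∈ (hF.prod hF).toFinset.biUnion d :=
    Finset.mem_biUnion.2 ⟨(A, B), by simpa using ⟨hA, hB⟩, hat⟩
  exact ha (by simpa [hmem] using Finset.ext_iff.1 hAB a)

/-- The Engelking–Karłowicz theorem. -/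
theorem exists_isIndependentOn {X I : Type u} [Infinite I] (hX : #X ≤ 2 ^ #I) :
    ∃ h : X → I → I, IsIndependentOn h univ univ := by
  classical
  obtain ⟨ι⟩ : Nonempty (X ↪ Set I) := by rwa [← mk_set] at hX
  let _ : Zero I := ⟨Classical.arbitrary I⟩
  have hcard : #I = #(Finset I × (Finset I →₀ I)) := by simp
  obtain ⟨e⟩ := Cardinal.eq.1 hcard
  refine ⟨fun x i => (e i).2 {a ∈ (e i).1 | a ∈ ι x}, fun s _ v => ?_⟩
  obtain ⟨t, ht⟩ := exists_finset_injOn_filter (ι '' s) (s.finite_toSet.image ι)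
  let trace : X → Finset I := fun x => {a ∈ t | a ∈ ι x}
  have htrace : InjOn trace s :=
    ht.comp ι.injective.injOn (mapsTo_image ι s)
  obtain ⟨g, hg⟩ : ∃ g : Finset I → I, ∀ x ∈ s, g (trace x) = v x :=
    ⟨Function.extend ((s : Set X).domRestrict trace) (fun x => v x) 0,
      fun x hx => htrace.injective.extend_apply (fun x => v x) 0 ⟨x, hx⟩⟩
  let φ : Finset I →₀ I := Finsupp.indicator (s.image trace) fun a _ => g a
  refine ⟨e.symm (t, φ), mem_univ _, fun x hx => ?_⟩
  have hφ : φ (trace x) = v x := by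
    rw [Finsupp.indicator_of_mem (Finset.mem_image_of_mem trace hx), hg x hx]
  simpa only [Equiv.apply_symm_apply] using hφ

theorem exists_isIndependentOn_prescribed {X W I : Type u} [Infinite I] (hX : #X ≤ 2 ^ #I)
    (hW : #W ≤ #I) : ∃ (h : X → I → I) (q : I → W → ℚ) (u : I → Finset I),
      ∀ (b : Finset W) (r : W → ℚ) (c : Finset I),
        IsIndependentOn h univ {i | (∀ w ∈ b, q i w = r w) ∧ u i = c} := by
  classical
  have hXopt : #(Option X) ≤ 2 ^ #I := by
    rw [mk_option]
    exact add_le_of_le ((aleph0_le_mk I).trans (cantor _).le) hX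
      (one_le_aleph0.trans ((aleph0_le_mk I).trans (cantor _).le))
  obtain ⟨k, hk⟩ := exists_isIndependentOn hXopt
  obtain ⟨ι⟩ : Nonempty (W ↪ I) := hW
  have hcard : #((W →₀ ℚ) × Finset I) ≤ #I := by
    have : #(W →₀ ℚ) ≤ #I := (mk_le_of_injective (Finsupp.embDomain_injective ι)).trans (by simp)
    simpa using mul_le_of_le (aleph0_le_mk I) this le_rfl
  obtain ⟨ε⟩ := hcard
  obtain ⟨π, hπ⟩ : ∃ π : I → (W →₀ ℚ) × Finset I, Function.Surjective π :=
    ⟨_, Function.invFun_surjective ε.injective⟩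
  refine ⟨fun x => k (some x), fun i => (π (k none i)).1, fun i => (π (k none i)).2,
    fun b r c => ?_⟩
  obtain ⟨z, hz⟩ := hπ (Finsupp.indicator b fun w _ => r w, c)
  refine (hk.comp_some z).mono fun i hi => ?_
  rw [mem_ofPred_eq] at hi
  simp only [mem_ofPred_eq, hi, hz, and_true]
  exact fun w hw => Finsupp.indicator_of_mem hw _

end Independence

section FrequentlyBounds

/-- Along `L`, every map into `J` is frequently `r`-bounded by a single element of `J`, also when
it is restricted to a set which is met frequently. -/
def FrequentlyBounds {Θ J : Type*} (L : Filter Θ) (r : J → J → Prop) : Prop :=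
  ∀ (S : Set Θ) (φ : Θ → J), (∃ᶠ ζ in L, ζ ∈ S) → ∃ j, ∃ᶠ ζ in L, ζ ∈ S ∧ r (φ ζ) j

namespace FrequentlyBounds

variable {Θ Θ' J K : Type*} {L : Filter Θ} {r : J → J → Prop}

theorem prod {s : K → K → Prop} (hr : FrequentlyBounds L r) (hs : FrequentlyBounds L s) :
    FrequentlyBounds L fun a b : J × K => r a.1 b.1 ∧ s a.2 b.2 := by
  intro S φ hS
  obtain ⟨j, hj⟩ := hr S (fun ζ => (φ ζ).1) hS
  obtain ⟨k, hk⟩ := hs {ζ | ζ ∈ S ∧ r (φ ζ).1 j} (fun ζ => (φ ζ).2) hj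
  exact ⟨(j, k), hk.mono fun _ hζ => ⟨hζ.1.1, hζ.1.2, hζ.2⟩⟩

theorem comap {π : K → J} (hr : FrequentlyBounds L r) (hπ : Function.Surjective π) :
    FrequentlyBounds L fun a b => r (π a) (π b) := by
  intro S φ hS
  obtain ⟨j, hj⟩ := hr S (fun ζ => π (φ ζ)) hS
  obtain ⟨k, rfl⟩ := hπ j
  exact ⟨k, hj⟩

theorem map (hr : FrequentlyBounds L r) (f : Θ → Θ') : FrequentlyBounds (L.map f) r :=
  fun S φ hS => hr (f ⁻¹' S) (φ ∘ f) hS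

end FrequentlyBounds

theorem frequentlyBounds_of_card_lt {Θ J : Type u} {L : Filter Θ} (c : Cardinal.{u})
    [CardinalInterFilter L c] (hJ : #J < c) {r : J → J → Prop} (hr : ∀ j, r j j) :
    FrequentlyBounds L r := by
  intro S φ hS
  by_contra! hcon
  have hne : ∀ᶠ ζ in L, ∀ j, ζ ∈ S → ¬ r (φ ζ) j :=
    (eventually_cardinal_forall hJ).2 fun j => by simpa [not_frequently] using hcon j
  obtain ⟨ζ, hζS, hζ⟩ := (hS.and_eventually hne).exists
  exact hζ (φ ζ) hζS (hr _)

theorem frequentlyBounds_of_card_lt_cof {Θ J : Type u} {L : Filter Θ} [LinearOrder J]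
    (hΘ : #Θ < Order.cof J) : FrequentlyBounds L ((· ≤ ·) : J → J → Prop) := by
  intro S φ hS
  have hφ : ¬ IsCofinal (range φ) := fun h => (mk_range_le.trans_lt hΘ).not_ge (Order.cof_le h)
  obtain ⟨j, hj⟩ := BddAbove.of_not_isCofinal hφ
  exact ⟨j, hS.mono fun ζ hζ => ⟨hζ, hj (mem_range_self ζ)⟩⟩

instance cardinalInterFilter_atTop (Θ : Type u) [LinearOrder Θ] [Nonempty Θ] :
    CardinalInterFilter (atTop : Filter Θ) (Order.cof Θ) where
  cardinal_sInter_mem S hSc hS := by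
    choose a ha using fun s : S => mem_atTop_sets.1 (hS s s.2)
    have hcof : ¬ IsCofinal (range a) := fun h =>
      (mk_range_le.trans_lt hSc).not_ge (Order.cof_le h)
    obtain ⟨x, hx⟩ := BddAbove.of_not_isCofinal hcof
    exact mem_of_superset (Ici_mem_atTop x) fun y hy s hs =>
      ha ⟨s, hs⟩ y ((hx (mem_range_self _)).trans hy)

theorem frequentlyBounds_atTop {θ κ : Cardinal.{u}} (hθ : θ.IsRegular) (hκ : κ.IsRegular)
    (hne : θ ≠ κ) :
    FrequentlyBounds (atTop : Filter θ.ord.ToType)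
      ((· ≤ ·) : κ.ord.ToType → κ.ord.ToType → Prop) := by
  have : Nonempty θ.ord.ToType := by simpa using hθ.ne_zero
  rcases hne.lt_or_gt with h | h
  · exact frequentlyBounds_of_card_lt_cof (by simpa [hκ.cof_ord])
  · exact frequentlyBounds_of_card_lt (Order.cof θ.ord.ToType) (by simpa [hθ.cof_ord]) le_refl

end FrequentlyBounds

section DeltaSystem

theorem frequently_exists_nat {Θ : Type*} {L : Filter Θ} [CountableInterFilter L]
    {p : Θ → ℕ → Prop} (h : ∃ᶠ ζ in L, ∃ n, p ζ n) : ∃ n, ∃ᶠ ζ in L, p ζ n := by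
  by_contra! hcon
  refine h ?_
  simpa only [not_exists, not_frequently, eventually_countable_forall] using hcon

/-- The root is a set of maximal size which is contained in frequently many of the sets. -/
theorem exists_deltaSystem_root {Θ α : Type*} {L : Filter Θ} [CountableInterFilter L] {S : Set Θ}
    (hS : ∃ᶠ ζ in L, ζ ∈ S) (s : Θ → Finset α) :
    ∃ (T : Set Θ) (r : Finset α), T ⊆ S ∧ (∃ᶠ ζ in L, ζ ∈ T) ∧ (∀ ζ ∈ T, r ⊆ s ζ) ∧
      ∀ x ∉ r, ∀ᶠ ζ in L, ζ ∈ T → x ∉ s ζ := by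
  classical
  obtain ⟨n, hn⟩ : ∃ n, ∃ᶠ ζ in L, ζ ∈ S ∧ (s ζ).card = n :=
    frequently_exists_nat (hS.mono fun ζ hζ => ⟨_, hζ, rfl⟩)
  let T : Finset α → Set Θ := fun r => {ζ ∈ S | (s ζ).card = n ∧ r ⊆ s ζ}
  let P : ℕ → Prop := fun k => ∃ r, r.card = k ∧ ∃ᶠ ζ in L, ζ ∈ T r
  have hP_zero : P 0 := ⟨∅, rfl, hn.mono fun ζ hζ => ⟨hζ.1, hζ.2, by simp⟩⟩
  have hP_le : ∀ k, P k → k ≤ n := by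
    rintro k ⟨r, rfl, hr⟩
    obtain ⟨ζ, -, hζn, hrζ⟩ := hr.exists
    exact hζn ▸ Finset.card_le_card hrζ
  obtain ⟨r, hrk, hr⟩ := Nat.findGreatest_spec (P := P) (Nat.zero_le n) hP_zero
  refine ⟨T r, r, fun ζ hζ => hζ.1, hr, fun ζ hζ => hζ.2.2, fun x hx => ?_⟩
  by_contra hcon
  have hinsert : ∃ᶠ ζ in L, ζ ∈ T (insert x r) := by
    refine (not_eventually.1 hcon).mono fun ζ hζ => ?_
    obtain ⟨hζT, hxζ⟩ := Classical.not_imp.1 hζ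
    exact ⟨hζT.1, hζT.2.1, Finset.insert_subset (not_not.1 hxζ) hζT.2.2⟩
  have hP_succ : P (Nat.findGreatest P n + 1) :=
    ⟨insert x r, by rw [Finset.card_insert_of_notMem hx, hrk], hinsert⟩
  have := Nat.le_findGreatest (hP_le _ hP_succ) hP_succ
  omega

end DeltaSystem

section BoundingProblem

/-- The problem of finding an internal bound for the directed set `(J, le)`: the relations
`rel i` are internal versions of `le`, and a bound modulo a filter `D` on `I` is a function
`h : I → J` such that each `j : J` is `rel i`-below `h i` for `D`-almost all `i`. -/
@[ext]
structure BoundingProblem (I J : Type*) where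
  le : J → J → Prop
  rel : I → J → J → Prop
  directed : ∀ j k, ∃ l, le j l ∧ le k l
  refl : ∀ i j, rel i j j
  trans : ∀ {i j k l}, rel i j k → rel i k l → rel i j l

namespace BoundingProblem

variable {I J K : Type*} (P : BoundingProblem I J)

/-- Modulo `D`, the internal relations extend the directed relation on `J`; this makes `P` a
finitely satisfiable problem. -/
def IsMonotone (D : Filter I) : Prop :=
  ∀ j k, P.le j k → ∀ᶠ i in D, P.rel i j k

/-- The problem has a solution modulo `D`. -/
def IsBounded (D : Filter I) : Prop :=
  ∃ h : I → J, ∀ j, ∀ᶠ i in D, P.rel i j (h i)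

/-- The least filter modulo which `h` is a solution. -/
def boundFilter (h : I → J) : Filter I :=
  ⨅ j, 𝓟 {i | P.rel i j (h i)}

/-- The problem on `K` which is induced by a surjection of `K` onto `J`. -/
def comap (π : K → J) (hπ : Function.Surjective π) : BoundingProblem I K where
  le a b := P.le (π a) (π b)
  rel i a b := P.rel i (π a) (π b)
  directed a b := by
    obtain ⟨l, hl⟩ := P.directed (π a) (π b)
    obtain ⟨c, rfl⟩ := hπ l
    exact ⟨c, hl⟩
  refl i a := P.refl i (π a)
  trans := P.trans

variable {P}

theorem IsBounded.of_comap {π : K → J} {hπ : Function.Surjective π} {D : Filter I}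
    (h : (P.comap π hπ).IsBounded D) : P.IsBounded D := by
  obtain ⟨g, hg⟩ := h
  exact ⟨π ∘ g, hπ.forall.2 hg⟩

theorem IsMonotone.exists_of_mem_inf_boundFilter [Nonempty J] {D : Filter I} (hP : P.IsMonotone D)
    {h : I → J} {A : Set I} (hA : A ∈ D ⊓ P.boundFilter h) :
    ∃ j, ∃ B ∈ D, B ∩ {i | P.rel i j (h i)} ⊆ A := by
  have hdir : Directed (· ≥ ·) fun j => D ⊓ 𝓟 {i | P.rel i j (h i)} := by
    have hle : ∀ {j l}, P.le j l → D ⊓ 𝓟 {i | P.rel i l (h i)} ≤ D ⊓ 𝓟 {i | P.rel i j (h i)} :=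
      fun {j l} hjl => le_inf inf_le_left <| le_principal_iff.2 <| mem_inf_principal.2 <|
        (hP j l hjl).mono fun _ => P.trans
    intro j k
    obtain ⟨l, hjl, hkl⟩ := P.directed j k
    exact ⟨l, hle hjl, hle hkl⟩
  rw [boundFilter, inf_iInf, mem_iInf_of_directed hdir] at hA
  obtain ⟨j, hj⟩ := hA
  exact ⟨j, _, mem_inf_principal.1 hj, fun i hi => hi.1 hi.2⟩

theorem IsMonotone.exists_common_bound {Θ₁ Θ₂ : Type w} {L₁ : Filter Θ₁} {L₂ : Filter Θ₂}
    {D : Filter I} (hP : P.IsMonotone D) (hL : FrequentlyBounds L₁ P.le ∨ FrequentlyBounds L₂ P.le)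
    {S₁ : Set Θ₁} {S₂ : Set Θ₂} (hS₁ : ∃ᶠ ξ in L₁, ξ ∈ S₁) (hS₂ : ∃ᶠ ζ in L₂, ζ ∈ S₂)
    (a : Θ₁ → J) (b : Θ₂ → J) :
    ∃ T₁ ⊆ S₁, (∃ᶠ ξ in L₁, ξ ∈ T₁) ∧ ∃ T₂ ⊆ S₂, (∃ᶠ ζ in L₂, ζ ∈ T₂) ∧
      ∃ (m : Θ₁ → Θ₂ → J) (U : Θ₁ → Set I) (V : Θ₂ → Set I),
        (∀ ξ, U ξ ∈ D) ∧ (∀ ζ, V ζ ∈ D) ∧ ∀ ξ ∈ T₁, ∀ ζ ∈ T₂, ∀ i ∈ U ξ ∩ V ζ,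
          P.rel i (a ξ) (m ξ ζ) ∧ P.rel i (b ζ) (m ξ ζ) := by
  wlog h : FrequentlyBounds L₁ P.le generalizing Θ₁ Θ₂ L₁ L₂ S₁ S₂ a b
  · obtain ⟨T₂, hT₂S, hT₂, T₁, hT₁S, hT₁, m, V, U, hV, hU, hm⟩ :=
      this hL.symm hS₂ hS₁ b a (hL.resolve_left h)
    exact ⟨T₁, hT₁S, hT₁, T₂, hT₂S, hT₂, fun ξ ζ => m ζ ξ, U, V, hU, hV,
      fun ξ hξ ζ hζ i hi => (hm ζ hζ ξ hξ i hi.symm).symm⟩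
  obtain ⟨j, hj⟩ := h S₁ a hS₁
  choose l hbl hjl using fun ζ => P.directed (b ζ) j
  refine ⟨{ξ | ξ ∈ S₁ ∧ P.le (a ξ) j}, fun ξ hξ => hξ.1, hj, S₂, Subset.rfl, hS₂,
    fun _ ζ => l ζ, fun ξ => {i | P.le (a ξ) j → P.rel i (a ξ) j},
    fun ζ => {i | P.rel i (b ζ) (l ζ) ∧ P.rel i j (l ζ)},
    fun ξ => eventually_imp_distrib_left.2 (hP _ _),
    fun ζ => (hP _ _ (hbl ζ)).and (hP _ _ (hjl ζ)),
    fun ξ hξ ζ _ i hi => ⟨P.trans (hi.1 hξ.2) hi.2.2, hi.2.1⟩⟩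

end BoundingProblem

end BoundingProblem

section MeetsFreely

variable {I J X : Type*} {Θ₁ Θ₂ : Type w} {L₁ : Filter Θ₁} {L₂ : Filter Θ₂}
  {T : Θ₁ → Θ₂ → Set I} {h : X → I → J} {Y : Set X} {D : Filter I}

/-- Given members `U ξ` and `V ζ` of `D`, indexed by sets which are met frequently, the functions
`h x` with `x ∈ Y` are independent on `U ξ ∩ V ζ ∩ T ξ ζ` for some `ξ` and frequently many `ζ`.
This is the invariant which keeps `D` proper, and keeps the sets `T ξ ζ` positive, when more
sets which are defined from the functions `h x` are added to `D`. -/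
def MeetsFreely (L₁ : Filter Θ₁) (L₂ : Filter Θ₂) (T : Θ₁ → Θ₂ → Set I) (h : X → I → J)
    (Y : Set X) (D : Filter I) : Prop :=
  ∀ (S₁ : Set Θ₁) (S₂ : Set Θ₂) (U : Θ₁ → Set I) (V : Θ₂ → Set I),
    (∃ᶠ ξ in L₁, ξ ∈ S₁) → (∃ᶠ ζ in L₂, ζ ∈ S₂) → (∀ ξ, U ξ ∈ D) → (∀ ζ, V ζ ∈ D) →
      ∃ ξ ∈ S₁, ∃ᶠ ζ in L₂, ζ ∈ S₂ ∧ IsIndependentOn h Y (U ξ ∩ V ζ ∩ T ξ ζ)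

theorem MeetsFreely.exists_common_bound (hD : MeetsFreely L₁ L₂ T h Y D) {P : BoundingProblem I J}
    (hP : P.IsMonotone D) (hL : FrequentlyBounds L₁ P.le ∨ FrequentlyBounds L₂ P.le)
    {S₁ : Set Θ₁} {S₂ : Set Θ₂} (hS₁ : ∃ᶠ ξ in L₁, ξ ∈ S₁) (hS₂ : ∃ᶠ ζ in L₂, ζ ∈ S₂)
    {U : Θ₁ → Set I} {V : Θ₂ → Set I} (hU : ∀ ξ, U ξ ∈ D) (hV : ∀ ζ, V ζ ∈ D)
    (a : Θ₁ → J) (b : Θ₂ → J) :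
    ∃ ξ ∈ S₁, ∃ᶠ ζ in L₂, ζ ∈ S₂ ∧ ∃ A ⊆ U ξ ∩ V ζ ∩ T ξ ζ, IsIndependentOn h Y A ∧
      ∃ m, ∀ i ∈ A, P.rel i (a ξ) m ∧ P.rel i (b ζ) m := by
  obtain ⟨T₁, hT₁S, hT₁, T₂, hT₂S, hT₂, m, U', V', hU', hV', hm⟩ :=
    hP.exists_common_bound hL hS₁ hS₂ a b
  obtain ⟨ξ, hξ, hfreq⟩ := hD T₁ T₂ (fun ξ => U ξ ∩ U' ξ) (fun ζ => V ζ ∩ V' ζ) hT₁ hT₂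
    (fun ξ => inter_mem (hU ξ) (hU' ξ)) fun ζ => inter_mem (hV ζ) (hV' ζ)
  exact ⟨ξ, hT₁S hξ, hfreq.mono fun ζ hζ => ⟨hT₂S hζ.1, _,
    fun i hi => ⟨⟨hi.1.1.1, hi.1.2.1⟩, hi.2⟩, hζ.2, m ξ ζ,
    fun i hi => hm ξ hξ ζ hζ.1 i ⟨hi.1.1.2, hi.1.2.2⟩⟩⟩

end MeetsFreely

section Iteration

variable {I J X : Type*}

/-- The data for solving bounding problems one by one along a well-order `X`: the filter one starts
with, the problem which is considered at stage `x`, and the function which is made a solution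
of it, provided that the problem is monotone modulo the filter of stage `x`. -/
structure BoundingIteration (I J X : Type*) where
  base : Filter I
  problem : X → BoundingProblem I J
  bound : X → I → J

namespace BoundingIteration

variable (F : BoundingIteration I J X)

/-- The points at which the functions `F.bound x` of the stages `x ∈ s` bound the elements `v x`.
These sets generate the filters of the iteration. -/
def bounded (s : Set X) (v : X → J) : Set I :=
  {i | ∀ x ∈ s, (F.problem x).rel i (v x) (F.bound x i)}

/-- The functions `F.bound x` are fresh: as long as the values of those with index in `Z` are kept,
the others can be set to upper bounds which exist pointwise. -/
theorem isIndependentOn_inter_bounded {F : BoundingIteration I J X} {Y Z : Set X} (hZY : Z ⊆ Y)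
    {A : Set I} (hA : IsIndependentOn F.bound Zᶜ A) {s t : Finset X} (hsY : ↑s ⊆ Y) (htY : ↑t ⊆ Y)
    {a b : X → J} (hAs : A ⊆ F.bounded (↑s ∩ Z) a) (hAt : A ⊆ F.bounded (↑t ∩ Z) b)
    (hst : ∀ z ∈ s, z ∈ t → z ∉ Z → ∃ m, ∀ i ∈ A,
      (F.problem z).rel i (a z) m ∧ (F.problem z).rel i (b z) m) :
    IsIndependentOn F.bound Yᶜ (A ∩ (F.bounded s a ∩ F.bounded t b)) := by
  classical
  have hm : ∀ z, ∃ m, z ∉ Z → ∀ i ∈ A, (z ∈ s → (F.problem z).rel i (a z) m) ∧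
      (z ∈ t → (F.problem z).rel i (b z) m) := by
    intro z
    by_cases hs : z ∈ s
    · by_cases ht : z ∈ t
      · by_cases hz : z ∈ Z
        · exact ⟨a z, fun h => absurd hz h⟩
        · obtain ⟨m, hm⟩ := hst z hs ht hz
          exact ⟨m, fun _ i hi => ⟨fun _ => (hm i hi).1, fun _ => (hm i hi).2⟩⟩
      · exact ⟨a z, fun _ i _ => ⟨fun _ => (F.problem z).refl i _, fun h => absurd h ht⟩⟩
    · exact ⟨b z, fun _ i _ => ⟨fun h => absurd h hs, fun _ => (F.problem z).refl i _⟩⟩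
  choose m hm using hm
  intro e he v
  obtain ⟨i, hi, hiv⟩ := hA (e ∪ {z ∈ s ∪ t | z ∉ Z}) (by
    intro z hz
    rcases Finset.mem_union.1 hz with hz | hz
    · exact fun hzZ => he hz (hZY hzZ)
    · exact (Finset.mem_filter.1 hz).2) fun z => if z ∈ Y then m z else v z
  have hnew : ∀ z ∈ s ∪ t, z ∉ Z → F.bound z i = m z := fun z hz hzZ => by
    rw [hiv z (by simp_all), if_pos ((Finset.mem_union.1 hz).elim (hsY ·) (htY ·))]
  refine ⟨i, ⟨hi, fun z hz => ?_, fun z hz => ?_⟩, fun z hz => ?_⟩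
  · by_cases hzZ : z ∈ Z
    · exact hAs hi z ⟨hz, hzZ⟩
    · rw [hnew z (Finset.mem_union_left _ hz) hzZ]
      exact (hm z hzZ i hi).1 hz
  · by_cases hzZ : z ∈ Z
    · exact hAt hi z ⟨hz, hzZ⟩
    · rw [hnew z (Finset.mem_union_right _ hz) hzZ]
      exact (hm z hzZ i hi).2 hz
  · rw [hiv z (Finset.mem_union_left _ hz), if_neg (he hz)]

variable [LinearOrder X]

/-- The filter which is constructed before stage `x`. -/
noncomputable def stage [WellFoundedLT X] (x : X) : Filter I :=
  F.base ⊓ ⨅ y : Iio x, ⨅ _ : (F.problem y).IsMonotone (stage y),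
    (F.problem y).boundFilter (F.bound y)
termination_by wellFounded_lt.wrap x
decreasing_by exact y.2

variable [WellFoundedLT X]

/-- The problem of stage `x` is solved by the iteration. -/
def IsActive (x : X) : Prop :=
  (F.problem x).IsMonotone (F.stage x)

/-- The filter which is constructed by the active stages in `Y`. -/
noncomputable def filter (Y : Set X) : Filter I :=
  F.base ⊓ ⨅ y ∈ Y, ⨅ _ : F.IsActive y, (F.problem y).boundFilter (F.bound y)

/-- `A` belongs to `F.filter Y` because of the active stages `x ∈ s` and their elements `v x`. -/
def HasSupport (Y : Set X) (A : Set I) : Prop :=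
  ∃ s : Finset X, ↑s ⊆ Y ∧ (∀ x ∈ s, F.IsActive x) ∧ ∃ v, ∃ B ∈ F.base, B ∩ F.bounded s v ⊆ A

variable {F}

theorem stage_eq_filter (x : X) : F.stage x = F.filter (Iio x) := by
  rw [stage, filter, iInf_subtype]
  rfl

theorem filter_anti : Antitone F.filter := fun _ _ h =>
  inf_le_inf_left _ (biInf_mono h)

theorem filter_le_base (Y : Set X) : F.filter Y ≤ F.base := inf_le_left

theorem filter_insert (y : X) (Y : Set X) : F.filter (insert y Y) =
    F.filter Y ⊓ ⨅ _ : F.IsActive y, (F.problem y).boundFilter (F.bound y) := by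
  rw [filter, filter, iInf_insert, inf_left_comm, inf_comm]

theorem eventually_rel_bound {Y : Set X} {x : X} (hxY : x ∈ Y) (hx : F.IsActive x) (j : J) :
    ∀ᶠ i in F.filter Y, (F.problem x).rel i j (F.bound x i) :=
  mem_inf_of_right <| mem_iInf_of_mem x <| mem_iInf_of_mem hxY <| mem_iInf_of_mem hx <|
    mem_iInf_of_mem j <| mem_principal_self _

theorem bounded_mem_filter {Y : Set X} {s : Set X} (hs : s.Finite) (hsY : s ⊆ Y)
    (hact : ∀ x ∈ s, F.IsActive x) (v : X → J) : F.bounded s v ∈ F.filter Y :=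
  (eventually_all_finite hs).2 fun x hx => eventually_rel_bound (hsY hx) (hact x hx) (v x)

theorem exists_finset_of_mem_filter {Y : Set X} {A : Set I} (hA : A ∈ F.filter Y) :
    ∃ t : Finset X, ↑t ⊆ Y ∧ A ∈ F.filter t := by
  classical
  obtain ⟨B, hB, C, hC, rfl⟩ := hA
  obtain ⟨t, ht⟩ := mem_iInf_finite _ |>.1 hC
  refine ⟨{x ∈ t | x ∈ Y}, fun x hx => (Finset.mem_filter.1 hx).2, inter_mem_inf hB ?_⟩
  simpa only [Finset.coe_filter, mem_ofPred_eq, iInf_and] using ht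

theorem mem_base_or_exists_mem_stage [Nonempty J] {Y : Set X} {A : Set I} (hA : A ∈ F.filter Y) :
    A ∈ F.base ∨ ∃ y ∈ Y, F.IsActive y ∧
      ∃ j, ∃ B ∈ F.stage y, B ∩ {i | (F.problem y).rel i j (F.bound y i)} ⊆ A := by
  obtain ⟨t, htY, hAt⟩ := exists_finset_of_mem_filter hA
  induction t using Finset.induction_on_max with
  | empty => exact Or.inl (by simpa [filter] using hAt)
  | insert y t hty ih =>
    rw [Finset.coe_insert, insert_subset_iff] at htY
    rw [Finset.coe_insert, filter_insert] at hAt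
    by_cases hy : F.IsActive y
    · rw [iInf_pos hy] at hAt
      have hle : F.stage y ≤ F.filter t := stage_eq_filter (F := F) y ▸ filter_anti hty
      exact Or.inr ⟨y, htY.1, hy, hy.exists_of_mem_inf_boundFilter (inf_le_inf_right _ hle hAt)⟩
    · rw [iInf_neg hy, inf_top_eq] at hAt
      exact ih htY.2 hAt

theorem hasSupport_of_mem_filter_of_stage [Nonempty J] {Y : Set X} (hY : IsLowerSet Y)
    (h : ∀ y ∈ Y, ∀ B ∈ F.stage y, F.HasSupport (Iio y) B) {A : Set I} (hA : A ∈ F.filter Y) :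
    F.HasSupport Y A := by
  classical
  rcases mem_base_or_exists_mem_stage hA with hA | ⟨y, hyY, hy, j, B, hB, hBA⟩
  · exact ⟨∅, by simp, by simp, fun _ => Classical.arbitrary J, A, hA, inter_subset_left⟩
  · obtain ⟨s, hsy, hs, v, C, hC, hCB⟩ := h y hyY B hB
    refine ⟨insert y s, ?_, ?_, Function.update v y j, C, hC, fun i hi => hBA ⟨hCB ⟨hi.1, ?_⟩, ?_⟩⟩
    · rw [Finset.coe_insert, insert_subset_iff]
      exact ⟨hyY, hsy.trans fun x hx => hY (mem_Iio.1 hx).le hyY⟩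
    · exact Finset.forall_mem_insert _ _ _ |>.2 ⟨hy, hs⟩
    · intro x hx
      simpa [(hsy hx).ne] using hi.2 x (Finset.mem_insert_of_mem hx)
    · simpa using hi.2 y (Finset.mem_insert_self y s)

theorem hasSupport_of_mem_filter [Nonempty J] {Y : Set X} (hY : IsLowerSet Y) {A : Set I}
    (hA : A ∈ F.filter Y) : F.HasSupport Y A := by
  have hstage : ∀ y, ∀ B ∈ F.stage y, F.HasSupport (Iio y) B := by
    intro y
    induction y using WellFoundedLT.induction with
    | ind y ih =>
      intro B hB
      rw [stage_eq_filter] at hB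
      exact hasSupport_of_mem_filter_of_stage (isLowerSet_Iio y) ih hB
  exact hasSupport_of_mem_filter_of_stage hY (fun y _ => hstage y) hA

section Preservation

variable {Θ₁ Θ₂ : Type w} {L₁ : Filter Θ₁} {L₂ : Filter Θ₂} {T : Θ₁ → Θ₂ → Set I} {Y : Set X}

/-- Only the problem of the last element `y` of `r` has to be solved. At stage `y`, this can be
done within the filter of that stage, which takes care of the smaller elements of `r`. -/
theorem exists_isIndependentOn_compl (hY : IsLowerSet Y)
    (hF : ∀ x, FrequentlyBounds L₁ (F.problem x).le ∨ FrequentlyBounds L₂ (F.problem x).le)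
    (hbase : MeetsFreely L₁ L₂ T F.bound univ F.base)
    (hstage : ∀ y ∈ Y, MeetsFreely L₁ L₂ T F.bound (Iio y)ᶜ (F.stage y))
    {S₁ : Set Θ₁} {S₂ : Set Θ₂} (hS₁ : ∃ᶠ ξ in L₁, ξ ∈ S₁) (hS₂ : ∃ᶠ ζ in L₂, ζ ∈ S₂)
    {s : Θ₁ → Finset X} {t : Θ₂ → Finset X} (hs : ∀ ξ, ∀ x ∈ s ξ, F.IsActive x)
    (ht : ∀ ζ, ∀ x ∈ t ζ, F.IsActive x) {r : Finset X} (hrY : ↑r ⊆ Y)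
    (hr : ∀ x ∈ r, F.IsActive x) {B : Θ₁ → Set I} {C : Θ₂ → Set I} (hB : ∀ ξ, B ξ ∈ F.base)
    (hC : ∀ ζ, C ζ ∈ F.base) (a : Θ₁ → X → J) (b : Θ₂ → X → J) :
    ∃ Z ⊆ Y, ∃ ξ ∈ S₁, ∃ᶠ ζ in L₂, ζ ∈ S₂ ∧ ∃ A ⊆ B ξ ∩ C ζ ∩ T ξ ζ,
      A ⊆ F.bounded (↑(s ξ) ∩ Z) (a ξ) ∧ A ⊆ F.bounded (↑(t ζ) ∩ Z) (b ζ) ∧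
      IsIndependentOn F.bound Zᶜ A ∧ ∀ z ∈ r, z ∉ Z → ∃ m, ∀ i ∈ A,
        (F.problem z).rel i (a ξ z) m ∧ (F.problem z).rel i (b ζ z) m := by
  rcases r.eq_empty_or_nonempty with rfl | hne
  · obtain ⟨ξ, hξ, hfreq⟩ := hbase S₁ S₂ B C hS₁ hS₂ hB hC
    refine ⟨∅, empty_subset _, ξ, hξ, hfreq.mono fun ζ hζ => ⟨hζ.1, _, Subset.rfl, ?_, ?_, ?_, ?_⟩⟩
    · exact fun i _ x hx => absurd hx.2 (notMem_empty x)
    · exact fun i _ x hx => absurd hx.2 (notMem_empty x)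
    · simpa using hζ.2
    · simp
  · let y := r.max' hne
    have hyr : y ∈ r := r.max'_mem hne
    have hbase_mem : ∀ A ∈ F.base, A ∈ F.stage y := fun A hA =>
      stage_eq_filter (F := F) y ▸ filter_le_base _ hA
    have hbounded : ∀ (e : Finset X) (v : X → J), (∀ x ∈ e, F.IsActive x) →
        F.bounded (↑e ∩ Iio y) v ∈ F.stage y := fun e v he => by
      rw [stage_eq_filter]
      exact bounded_mem_filter (e.finite_toSet.inter_of_left _) inter_subset_right
        (fun x hx => he x hx.1) v
    obtain ⟨ξ, hξ, hfreq⟩ := (hstage y (hrY hyr)).exists_common_bound (hr y hyr) (hF y) hS₁ hS₂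
      (fun ξ => inter_mem (hbase_mem _ (hB ξ)) (hbounded _ (a ξ) (hs ξ)))
      (fun ζ => inter_mem (hbase_mem _ (hC ζ)) (hbounded _ (b ζ) (ht ζ))) (a · y) (b · y)
    refine ⟨Iio y, fun x hx => hY (mem_Iio.1 hx).le (hrY hyr), ξ, hξ, hfreq.mono ?_⟩
    rintro ζ ⟨hζ, A, hA, hind, hm⟩
    refine ⟨hζ, A, fun i hi => ⟨⟨(hA hi).1.1.1, (hA hi).1.2.1⟩, (hA hi).2⟩,
      fun i hi => (hA hi).1.1.2, fun i hi => (hA hi).1.2.2, hind, fun z hz hzy => ?_⟩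
    rwa [(r.le_max' z hz).antisymm (not_lt.1 hzy)]

variable [Nonempty J] [CountableInterFilter L₂]

/-- Along a Δ-system of supports, two of them meet only in the root. -/
theorem meetsFreely_filter_of_stage (hY : IsLowerSet Y)
    (hF : ∀ x, FrequentlyBounds L₁ (F.problem x).le ∨ FrequentlyBounds L₂ (F.problem x).le)
    (hbase : MeetsFreely L₁ L₂ T F.bound univ F.base)
    (hstage : ∀ y ∈ Y, MeetsFreely L₁ L₂ T F.bound (Iio y)ᶜ (F.stage y)) :
    MeetsFreely L₁ L₂ T F.bound Yᶜ (F.filter Y) := by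
  intro S₁ S₂ U V hS₁ hS₂ hU hV
  choose s hsY hs a B hB hBU using fun ξ => hasSupport_of_mem_filter hY (hU ξ)
  choose t htY ht b C hC hCV using fun ζ => hasSupport_of_mem_filter hY (hV ζ)
  obtain ⟨R, r, hRS, hR, hrt, hfresh⟩ := exists_deltaSystem_root hS₂ t
  obtain ⟨ζ₀, hζ₀⟩ := hR.exists
  obtain ⟨Z, hZY, ξ, hξ, hfreq⟩ := exists_isIndependentOn_compl hY hF hbase hstage hS₁ hR hs ht
    (fun x hx => htY ζ₀ (hrt ζ₀ hζ₀ hx)) (fun x hx => ht ζ₀ x (hrt ζ₀ hζ₀ hx)) hB hC a b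
  have hdisj : ∀ᶠ ζ in L₂, ∀ z ∈ s ξ, z ∉ r → ζ ∈ R → z ∉ t ζ :=
    (Finset.eventually_all _).2 fun z _ => eventually_imp_distrib_left.2 (hfresh z)
  refine ⟨ξ, hξ, (hfreq.and_eventually hdisj).mono ?_⟩
  rintro ζ ⟨⟨hζ, A, hA, hAs, hAt, hind, hm⟩, hdisj⟩
  refine ⟨hRS hζ, (isIndependentOn_inter_bounded hZY hind (hsY ξ) (htY ζ) hAs hAt
    fun z hzs hzt => hm z (by_contra fun hzr => hdisj z hzs hzr hζ hzt)).mono ?_⟩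
  exact fun i ⟨hi, his, hit⟩ =>
    ⟨⟨hBU ξ ⟨(hA hi).1.1, his⟩, hCV ζ ⟨(hA hi).1.2, hit⟩⟩, (hA hi).2⟩

theorem meetsFreely_filter
    (hF : ∀ x, FrequentlyBounds L₁ (F.problem x).le ∨ FrequentlyBounds L₂ (F.problem x).le)
    (hbase : MeetsFreely L₁ L₂ T F.bound univ F.base) :
    MeetsFreely L₁ L₂ T F.bound ∅ (F.filter univ) := by
  have hstage : ∀ y, MeetsFreely L₁ L₂ T F.bound (Iio y)ᶜ (F.stage y) := by
    intro y
    induction y using WellFoundedLT.induction with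
    | ind y ih =>
      rw [stage_eq_filter]
      exact meetsFreely_filter_of_stage (isLowerSet_Iio y) hF hbase ih
  simpa using meetsFreely_filter_of_stage isLowerSet_univ hF hbase fun y _ => hstage y

end Preservation

end BoundingIteration

end Iteration

section Amalgamation

variable {W : Type*} [LinearOrder W]

theorem exists_strictMonoOn_rat (s : Finset W) : ∃ e : W → ℚ, StrictMonoOn e s := by
  refine ⟨fun w => ({v ∈ s | v < w}.card : ℚ), fun v hv w _ hvw => Nat.cast_lt.2 ?_⟩
  refine Finset.card_lt_card <| Finset.ssubset_iff_of_subset ?_ |>.2 ⟨v, ?_, ?_⟩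
  · exact Finset.monotone_filter_right s fun z _ hz => hz.trans hvw
  · simpa using ⟨hv, hvw⟩
  · simp

/-- The number of the element or gap of the finite set `d` to which `w` belongs: the gaps have
even numbers, and the elements have odd ones. -/
def gapIndex (d : Finset W) (w : W) : ℕ :=
  {v ∈ d | v < w}.card + {v ∈ d | v ≤ w}.card

theorem gapIndex_mono (d : Finset W) : Monotone (gapIndex d) := fun _ _ h => by
  unfold gapIndex
  gcongr

theorem gapIndex_lt_gapIndex {d : Finset W} {v w : W} (hvw : v < w) (hd : v ∈ d ∨ w ∈ d) :
    gapIndex d v < gapIndex d w := by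
  have hlt : {z ∈ d | z < v} ⊆ {z ∈ d | z < w} :=
    Finset.monotone_filter_right d fun z _ hz => hz.trans hvw
  have hle : {z ∈ d | z ≤ v} ⊆ {z ∈ d | z ≤ w} :=
    Finset.monotone_filter_right d fun z _ hz => hz.trans hvw.le
  rcases hd with hv | hw
  · exact add_lt_add_of_lt_of_le (Finset.card_lt_card <| Finset.ssubset_iff_of_subset hlt |>.2
      ⟨v, by simp [hv, hvw]⟩) (Finset.card_le_card hle)
  · exact add_lt_add_of_le_of_lt (Finset.card_le_card hlt) (Finset.card_lt_card <|
      Finset.ssubset_iff_of_subset hle |>.2 ⟨w, by simp [hw, hvw]⟩)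

theorem gapIndex_congr {d : Finset W} {v w : W}
    (h : ∀ z ∈ d, (z < v ∧ z < w) ∨ (v < z ∧ w < z)) : gapIndex d v = gapIndex d w := by
  refine congrArg₂ (· + ·) (congrArg Finset.card (Finset.filter_congr fun z hz => ?_))
    (congrArg Finset.card (Finset.filter_congr fun z hz => ?_))
  · rcases h z hz with ⟨h₁, h₂⟩ | ⟨h₁, h₂⟩ <;> simp [h₁, h₂, h₁.not_gt, h₂.not_gt]
  · rcases h z hz with ⟨h₁, h₂⟩ | ⟨h₁, h₂⟩ <;> simp [h₁.le, h₂.le, h₁.not_ge, h₂.not_ge]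

/-- Within a gap of `b ∩ c`, the elements of `c` are put before those of `b`. -/
theorem exists_strictMonoOn_of_inter_not_between (b c : Finset W) {f g : W} (hf : f ∈ b)
    (hg : g ∈ c) (h : ∀ w ∈ b, w ∈ c → (w < f ∧ w < g) ∨ (f < w ∧ g < w)) :
    ∃ r : W → ℚ, StrictMonoOn r b ∧ StrictMonoOn r c ∧ r g < r f := by
  classical
  let key : W → ℕ ×ₗ Prop ×ₗ W := fun w => toLex (gapIndex (b ∩ c) w, toLex (w ∈ b, w))
  obtain ⟨e, he⟩ := exists_strictMonoOn_rat ((b ∪ c).image key)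
  have hkey : ∀ {v w}, v < w → (v ∉ b ∩ c → w ∉ b ∩ c → v ∈ b → w ∈ b) → key v < key w := by
    intro v w hvw hb
    by_cases hd : v ∈ b ∩ c ∨ w ∈ b ∩ c
    · exact Prod.Lex.toLex_lt_toLex.2 (Or.inl (gapIndex_lt_gapIndex hvw hd))
    · rw [not_or] at hd
      refine Prod.Lex.toLex_lt_toLex.2 ((gapIndex_mono _ hvw.le).lt_or_eq.imp_right (⟨·, ?_⟩))
      exact Prod.Lex.toLex_lt_toLex.2 (Or.imp_right (⟨·, hvw⟩) <|
        lt_or_eq_of_le (show (v ∈ b) ≤ (w ∈ b) from hb hd.1 hd.2))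
  have hlt : ∀ {v w}, v ∈ b ∪ c → w ∈ b ∪ c → key v < key w → e (key v) < e (key w) :=
    fun hv hw => he (Finset.mem_image_of_mem key hv) (Finset.mem_image_of_mem key hw)
  refine ⟨e ∘ key, fun v hv w hw hvw => ?_, fun v hv w hw hvw => ?_, ?_⟩
  · exact hlt (Finset.mem_union_left _ hv) (Finset.mem_union_left _ hw)
      (hkey hvw fun _ _ _ => hw)
  · exact hlt (Finset.mem_union_right _ hv) (Finset.mem_union_right _ hw)
      (hkey hvw fun hvd _ hvb => absurd (Finset.mem_inter.2 ⟨hvb, hv⟩) hvd)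
  · have hgb : g ∉ b := fun hgb => (h g hgb hg).elim (fun h => h.2.false) fun h => h.2.false
    have hgap : gapIndex (b ∩ c) g = gapIndex (b ∩ c) f :=
      gapIndex_congr fun z hz => (h z (Finset.mem_inter.1 hz).1 (Finset.mem_inter.1 hz).2).imp
        And.symm And.symm
    refine hlt (Finset.mem_union_right _ hg) (Finset.mem_union_left _ hf) ?_
    exact Prod.Lex.toLex_lt_toLex.2 (Or.inr ⟨hgap, Prod.Lex.toLex_lt_toLex.2 (Or.inl (by
      simp [hgb, hf, lt_iff_le_not_ge]))⟩)

end Amalgamation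

section GenericChain

variable {W : Type u} [LinearOrder W] {L₁ L₂ : Filter W}

theorem exists_frequently_not_between [CountableInterFilter L₂]
    (hL : ∀ w, (∀ᶠ v in L₁ ⊔ L₂, w < v) ∨ ∀ᶠ v in L₁ ⊔ L₂, v < w)
    {S₁ S₂ : Set W} (hS₁ : ∃ᶠ ξ in L₁, ξ ∈ S₁) (hS₂ : ∃ᶠ ζ in L₂, ζ ∈ S₂) (b c : W → Finset W) :
    ∃ ξ ∈ S₁, ∃ᶠ ζ in L₂, ζ ∈ S₂ ∧
      ∀ w ∈ b ξ, w ∈ c ζ → (w < ξ ∧ w < ζ) ∨ (ξ < w ∧ ζ < w) := by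
  obtain ⟨R, r, hRS, hR, -, hfresh⟩ := exists_deltaSystem_root hS₂ c
  have hside : ∀ w, ∀ᶠ ξ in L₁, ∀ᶠ ζ in L₂, (w < ξ ∧ w < ζ) ∨ (ξ < w ∧ ζ < w) := by
    intro w
    rcases hL w with h | h
    · exact (eventually_sup.1 h).1.mono fun ξ hξ =>
        (eventually_sup.1 h).2.mono fun ζ hζ => Or.inl ⟨hξ, hζ⟩
    · exact (eventually_sup.1 h).1.mono fun ξ hξ =>
        (eventually_sup.1 h).2.mono fun ζ hζ => Or.inr ⟨hξ, hζ⟩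
  obtain ⟨ξ, hξS, hξ⟩ :=
    (hS₁.and_eventually ((Finset.eventually_all r).2 fun w _ => hside w)).exists
  have hdisj : ∀ᶠ ζ in L₂, ∀ w ∈ b ξ, w ∉ r → ζ ∈ R → w ∉ c ζ :=
    (Finset.eventually_all _).2 fun w _ => eventually_imp_distrib_left.2 (hfresh w)
  have hroot : ∀ᶠ ζ in L₂, ∀ w ∈ r, (w < ξ ∧ w < ζ) ∨ (ξ < w ∧ ζ < w) :=
    (Finset.eventually_all _).2 hξ
  refine ⟨ξ, hξS, (hR.and_eventually (hdisj.and hroot)).mono ?_⟩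
  exact fun ζ ⟨hζ, hdisj, hroot⟩ => ⟨hRS hζ, fun w hwb hwc =>
    hroot w (by_contra fun hwr => hdisj w hwb hwr hζ hwc)⟩

/-- The least filter `D` such that the functions `q · w`, for `w : W`, form an increasing chain
modulo `D` and the sets `u i` witness that `D` is regular. -/
def chainFilter {I : Type u} (q : I → W → ℚ) (u : I → Finset I) : Filter I :=
  ⨅ p : Finset W × Finset I, 𝓟 {i | StrictMonoOn (q i) p.1 ∧ p.2 ⊆ u i}

theorem mem_chainFilter {I : Type u} {q : I → W → ℚ} {u : I → Finset I} {A : Set I} :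
    A ∈ chainFilter q u ↔ ∃ (b : Finset W) (c : Finset I),
      {i | StrictMonoOn (q i) b ∧ c ⊆ u i} ⊆ A := by
  classical
  have hdir : Directed (· ≥ ·) fun p : Finset W × Finset I =>
      𝓟 {i | StrictMonoOn (q i) p.1 ∧ p.2 ⊆ u i} := by
    refine Antitone.directed_ge fun p p' hp => principal_mono.2 fun i hi => ?_
    exact ⟨hi.1.mono (Finset.coe_subset.2 hp.1), hp.2.trans hi.2⟩
  simp only [chainFilter, mem_iInf_of_directed hdir, mem_principal, Prod.exists]

theorem meetsFreely_chainFilter {X I : Type u} [CountableInterFilter L₂]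
    (hL : ∀ w, (∀ᶠ v in L₁ ⊔ L₂, w < v) ∨ ∀ᶠ v in L₁ ⊔ L₂, v < w) {h : X → I → I}
    {q : I → W → ℚ} {u : I → Finset I} (hind : ∀ (b : Finset W) (r : W → ℚ) (c : Finset I),
      IsIndependentOn h univ {i | (∀ w ∈ b, q i w = r w) ∧ u i = c}) :
    MeetsFreely L₁ L₂ (fun ξ ζ => {i | q i ζ < q i ξ}) h univ (chainFilter q u) := by
  classical
  intro S₁ S₂ U V hS₁ hS₂ hU hV
  choose b b' hbU using fun ξ => mem_chainFilter.1 (hU ξ)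
  choose c c' hcV using fun ζ => mem_chainFilter.1 (hV ζ)
  obtain ⟨ξ, hξ, hfreq⟩ := exists_frequently_not_between hL hS₁ hS₂ (fun ξ => insert ξ (b ξ))
    (fun ζ => insert ζ (c ζ))
  refine ⟨ξ, hξ, hfreq.mono fun ζ ⟨hζ, hsep⟩ => ⟨hζ, ?_⟩⟩
  obtain ⟨r, hrb, hrc, hr⟩ := exists_strictMonoOn_of_inter_not_between _ _
    (Finset.mem_insert_self ξ _) (Finset.mem_insert_self ζ _) hsep
  refine (hind (insert ξ (b ξ) ∪ insert ζ (c ζ)) r (b' ξ ∪ c' ζ)).mono ?_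
  rintro i ⟨hqr, hu⟩
  have hb : EqOn r (q i) (insert ξ (b ξ) : Finset W) :=
    fun w hw => (hqr w (Finset.mem_union_left _ hw)).symm
  have hc : EqOn r (q i) (insert ζ (c ζ) : Finset W) :=
    fun w hw => (hqr w (Finset.mem_union_right _ hw)).symm
  refine ⟨⟨hbU ξ ⟨(hrb.congr hb).mono (by simp), ?_⟩,
    hcV ζ ⟨(hrc.congr hc).mono (by simp), ?_⟩⟩, ?_⟩
  · exact hu ▸ Finset.subset_union_left
  · exact hu ▸ Finset.subset_union_right
  · rwa [mem_ofPred_eq, ← hc (Finset.mem_insert_self ζ _), ← hb (Finset.mem_insert_self ξ _)]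

/-- Modulo `D`, the functions `q · w`, for `w : W`, form an increasing chain, and every attempt to
fill the cut of this chain which is determined by the filters `L₁` and `L₂` fails at some index,
where the chain is not even increasing across the cut. -/
structure IsGenericChain {I : Type*} (D : Filter I) (L₁ L₂ : Filter W) (q : I → W → ℚ) : Prop where
  eventually_lt : ∀ {v w}, v < w → ∀ᶠ i in D, q i v < q i w
  exists_lt : ∀ {U V : W → Set I}, (∀ᶠ v in L₁, U v ∈ D) → (∀ᶠ w in L₂, V w ∈ D) →
    ∃ v w, ∃ i ∈ U v ∩ V w, q i w < q i v

namespace IsGenericChain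

variable {I : Type*} {D : Filter I} {q : I → W → ℚ}

theorem neBot (h : IsGenericChain D L₁ L₂ q) : D.NeBot := by
  refine ⟨fun hD => ?_⟩
  obtain ⟨_, _, _, hi, -⟩ := h.exists_lt (U := fun _ => ∅) (V := fun _ => ∅) (by simp [hD])
    (by simp [hD])
  exact hi.1

theorem of_dual {q : I → Wᵒᵈ → ℚ}
    (h : IsGenericChain D (L₂.map OrderDual.toDual) (L₁.map OrderDual.toDual) q) :
    IsGenericChain D L₁ L₂ fun i w => -q i (OrderDual.toDual w) where
  eventually_lt hvw := (h.eventually_lt (OrderDual.toDual_lt_toDual.2 hvw)).mono fun _ => neg_lt_neg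
  exists_lt {U V} hU hV := by
    obtain ⟨w, v, i, hi, hlt⟩ := h.exists_lt (U := V ∘ OrderDual.ofDual) (V := U ∘ OrderDual.ofDual)
      hV hU
    exact ⟨OrderDual.ofDual v, OrderDual.ofDual w, i, hi.symm, neg_lt_neg hlt⟩

end IsGenericChain

theorem MeetsFreely.isGenericChain {X I J : Type*} [Nonempty J] [L₁.NeBot] [L₂.NeBot]
    {q : I → W → ℚ} {h : X → I → J} {Y : Set X} {D : Filter I}
    (hD : MeetsFreely L₁ L₂ (fun ξ ζ => {i | q i ζ < q i ξ}) h Y D)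
    (hq : ∀ {v w}, v < w → ∀ᶠ i in D, q i v < q i w) : IsGenericChain D L₁ L₂ q where
  eventually_lt := hq
  exists_lt {U V} hU hV := by
    obtain ⟨ξ, hξ, hfreq⟩ := hD {ξ | U ξ ∈ D} {ζ | V ζ ∈ D} (fun ξ => {i | U ξ ∈ D → i ∈ U ξ})
      (fun ζ => {i | V ζ ∈ D → i ∈ V ζ}) hU.frequently hV.frequently
      (fun ξ => eventually_imp_distrib_left.2 id) (fun ζ => eventually_imp_distrib_left.2 id)
    obtain ⟨ζ, hζ, hind⟩ := hfreq.exists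
    obtain ⟨i, ⟨hiU, hiV⟩, hlt⟩ := hind.nonempty
    exact ⟨ξ, ζ, i, ⟨hiU hξ, hiV hζ⟩, hlt⟩

end GenericChain

section Existence

/-- The instances of monotonicity of `P` have small supports, so `P` is monotone at some early stage
already, and the iteration returns to it later. -/
theorem BoundingIteration.isBounded_filter {I J X : Type*} [LinearOrder X] [WellFoundedLT X]
    [Nonempty J] {F : BoundingIteration I J X} {P : BoundingProblem I J}
    (hP : P.IsMonotone (F.filter univ))
    (hF : ∀ s : J × J → Finset X, ∃ x, F.problem x = P ∧ ∀ p, ∀ y ∈ s p, y < x) :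
    P.IsBounded (F.filter univ) := by
  choose s _ hs v B hB hBA using fun p : J × J => hasSupport_of_mem_filter isLowerSet_univ
    (eventually_imp_distrib_left.2 (hP p.1 p.2))
  obtain ⟨x, rfl, hx⟩ := hF s
  have hact : F.IsActive x := by
    intro j k hjk
    rw [stage_eq_filter]
    filter_upwards [filter_le_base _ (hB (j, k)),
      bounded_mem_filter (s (j, k)).finite_toSet (hx (j, k)) (hs (j, k)) (v (j, k))] with i hi hi'
    exact hBA (j, k) ⟨hi, hi'⟩ hjk
  exact ⟨F.bound x, eventually_rel_bound (mem_univ x) hact⟩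

theorem exists_forall_mem_finset_lt {A K : Type u} [LinearOrder K] [Nonempty K]
    (hA : #A < Order.cof K) (s : A → Finset K) : ∃ c, ∀ a, ∀ k ∈ s a, k < c := by
  choose m hm using fun a => (s a).exists_le
  obtain ⟨c, hc⟩ := not_isCofinal_iff.1 fun h : IsCofinal (range m) =>
    (mk_range_le.trans_lt hA).not_ge (Order.cof_le h)
  exact ⟨c, fun a k hk => (hm a k hk).trans_lt (by simpa using hc (m a) (mem_range_self a))⟩

theorem mk_boundingProblem_le (I : Type u) [Infinite I] : #(BoundingProblem I I) ≤ 2 ^ #I := by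
  have hinj : Function.Injective fun P : BoundingProblem I I => (P.le, P.rel) := fun P Q h =>
    BoundingProblem.ext (Prod.ext_iff.1 h).1 (Prod.ext_iff.1 h).2
  refine (mk_le_of_injective hinj).trans ?_
  have h2 : ℵ₀ ≤ (2 : Cardinal.{u}) ^ #I := (aleph0_le_mk I).trans (cantor _).le
  simp [← power_mul, mul_eq_self (aleph0_le_mk I), mul_eq_self h2]

variable {I W : Type u} [Infinite I] [LinearOrder W] {L₁ L₂ : Filter W} [L₁.NeBot] [L₂.NeBot]

theorem exists_regular_filter_of_countableInter [CountableInterFilter L₂] (hW : #W ≤ #I)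
    (hL : ∀ w, (∀ᶠ v in L₁ ⊔ L₂, w < v) ∨ ∀ᶠ v in L₁ ⊔ L₂, v < w) :
    ∃ D : Filter I, IsRegularFilter D ∧ (∃ q, IsGenericChain D L₁ L₂ q) ∧
      ∀ P : BoundingProblem I I, FrequentlyBounds L₁ P.le ∨ FrequentlyBounds L₂ P.le →
        P.IsMonotone D → P.IsBounded D := by
  let Problem := {P : BoundingProblem I I // FrequentlyBounds L₁ P.le ∨ FrequentlyBounds L₂ P.le}
  obtain ⟨_, _⟩ := exists_wellFoundedLT Problem
  let K := (Order.succ #I).ord.ToType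
  have hcof : Order.cof K = Order.succ #I := by
    rw [Ordinal.cof_toType, (isRegular_succ (aleph0_le_mk I)).cof_ord]
  have : Nonempty K := by simp [K]
  have hX : #(K ×ₗ Problem) ≤ 2 ^ #I := by
    rw [mk_congr (ofLex : K ×ₗ Problem ≃ K × Problem), mk_prod, lift_id, lift_id, mk_ord_toType]
    exact mul_le_of_le ((aleph0_le_mk I).trans (cantor _).le) (Order.succ_le_of_lt (cantor _))
      ((mk_subtype_le _).trans (mk_boundingProblem_le I))
  obtain ⟨h, q, u, hind⟩ := exists_isIndependentOn_prescribed hX hW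
  let F : BoundingIteration I I (K ×ₗ Problem) :=
    { base := chainFilter q u, problem := fun x => (ofLex x).2, bound := h }
  have hbase := F.filter_le_base univ
  have hfree := F.meetsFreely_filter (fun x => (ofLex x).2.2) (meetsFreely_chainFilter hL hind)
  refine ⟨F.filter univ, ⟨u, fun a => hbase (mem_chainFilter.2 ⟨∅, {a}, by simp⟩)⟩, ⟨q,
    hfree.isGenericChain fun {v w} hvw => hbase (mem_chainFilter.2 ⟨{v, w}, ∅, fun i hi =>
      hi.1 (by simp) (by simp) hvw⟩)⟩, fun P hP hmono => ?_⟩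
  refine BoundingIteration.isBounded_filter hmono fun s => ?_
  obtain ⟨c, hc⟩ := exists_forall_mem_finset_lt (K := K) (by simp [hcof])
    fun p => (s p).image fun x => (ofLex x).1
  exact ⟨toLex (c, ⟨P, hP⟩), rfl, fun p y hy =>
    Prod.Lex.lt_iff.2 (Or.inl (hc p _ (Finset.mem_image_of_mem _ hy)))⟩

theorem exists_regular_filter (hW : #W ≤ #I)
    (hω : CountableInterFilter L₁ ∨ CountableInterFilter L₂)
    (hL : ∀ w, (∀ᶠ v in L₁ ⊔ L₂, w < v) ∨ ∀ᶠ v in L₁ ⊔ L₂, v < w) :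
    ∃ D : Filter I, IsRegularFilter D ∧ (∃ q, IsGenericChain D L₁ L₂ q) ∧
      ∀ {J : Type u} [Nonempty J] (P : BoundingProblem I J), #J ≤ #I →
        FrequentlyBounds L₁ P.le ∨ FrequentlyBounds L₂ P.le → P.IsMonotone D → P.IsBounded D := by
  obtain ⟨D, hreg, hq, hD⟩ : ∃ D : Filter I, IsRegularFilter D ∧ (∃ q, IsGenericChain D L₁ L₂ q) ∧
      ∀ P : BoundingProblem I I, FrequentlyBounds L₁ P.le ∨ FrequentlyBounds L₂ P.le →
        P.IsMonotone D → P.IsBounded D := by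
    rcases hω with hω | hω
    · obtain ⟨D, hreg, ⟨q, hq⟩, hD⟩ := exists_regular_filter_of_countableInter
        (L₁ := L₂.map OrderDual.toDual) (L₂ := L₁.map OrderDual.toDual) hW fun w =>
          by rw [← map_sup, sup_comm]; exact (hL (OrderDual.ofDual w)).symm
      exact ⟨D, hreg, ⟨_, hq.of_dual⟩, fun P hP => hD P (hP.symm.imp (·.map _) (·.map _))⟩
    · exact exists_regular_filter_of_countableInter hW hL
  refine ⟨D, hreg, hq, fun {J} _ P hJ hP hmono => ?_⟩
  obtain ⟨ι⟩ := hJ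
  let π := Function.invFun ι
  have hπ : Function.Surjective π := Function.invFun_surjective ι.injective
  exact (hD (P.comap π hπ) (hP.imp (·.comap hπ) (·.comap hπ)) fun j k => hmono _ _).of_comap

end Existence

section CofinalSequence

theorem exists_isCofinal_wellFoundedLT (C : Type w) [LinearOrder C] :
    ∃ t : Set C, IsCofinal t ∧ WellFoundedLT t := by
  let r : C → C → Prop := WellOrderingRel
  refine ⟨_, isCofinal_setOfPred_imp_lt r, ⟨Subrelation.wf (r := InvImage r (↑)) ?_
    (InvImage.wf _ WellOrderingRel.isWellOrder.wf)⟩⟩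
  intro a b hab
  rcases trichotomous_of r a.1 b.1 with h | h | h
  · exact h
  · exact absurd (Subtype.ext h) hab.ne
  · exact absurd (a.2 b h) hab.asymm

theorem exists_strictMono_isCofinal_range {C : Type w} [LinearOrder C] {κ : Cardinal.{u}}
    (h : lift.{u} (Order.cof C) = lift.{w} κ) :
    ∃ s : κ.ord.ToType → C, StrictMono s ∧ IsCofinal (range s) := by
  obtain ⟨t, ht, _⟩ := exists_isCofinal_wellFoundedLT C
  obtain ⟨c, hc, hct⟩ := Ordinal.exists_ord_cof_eq t
  have htype : Ordinal.lift.{w} (Ordinal.type (α := κ.ord.ToType) (· < ·)) =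
      Ordinal.lift.{u} (Ordinal.type (α := c) (· < ·)) := by
    rw [hct, Order.cof_eq_of_isCofinal ht, Ordinal.type_toType, lift_ord, lift_ord, h]
  obtain ⟨e⟩ := Ordinal.lift_type_eq.{u, w, 0}.1 htype
  refine ⟨fun a => e a, fun a b hab => e.map_rel_iff.2 hab, fun x => ?_⟩
  obtain ⟨y, hy, hxy⟩ := ht.trans hc x
  obtain ⟨z, hz, rfl⟩ := hy
  exact ⟨z, ⟨e.symm ⟨z, hz⟩, by simp⟩, hxy⟩

theorem exists_unbounded_tower {X : Type u} [Nonempty X] (r : X → X → Prop) [IsStrictOrder X r]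
    (hr : ∀ x, ∃ y, r x y) :
    ∃ κ : Cardinal.{u}, ℵ₀ ≤ κ ∧ ∃ f : κ.ord.ToType → X,
      (∀ α β, α < β → r (f α) (f β)) ∧ ¬ ∃ x, ∀ α, r (f α) x := by
  classical
  let _ : PartialOrder X := partialOrderOfSO r
  obtain ⟨c, hc, hub⟩ : ∃ c : Set X, IsChain (· < ·) c ∧ ¬ ∃ x, ∀ a ∈ c, a < x := by
    by_contra! hcon
    obtain ⟨m, hm⟩ := exists_maximal_of_chains_bounded hcon lt_trans
    obtain ⟨y, hy⟩ := hr m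
    exact lt_asymm hy (hm y hy)
  let _ : LinearOrder c := (hc.mono_rel fun _ _ => le_of_lt).linearOrder
  have : Nonempty c := by
    by_contra hempty
    exact hub ⟨Classical.arbitrary X, fun a ha => absurd ⟨a, ha⟩ hempty⟩
  have hub' : ∀ x, ∃ a : c, ¬ (a : X) < x := by simpa using hub
  have : NoMaxOrder c := ⟨fun a => by
    obtain ⟨y, hy⟩ := hr a
    obtain ⟨b, hb⟩ := hub' y
    exact ⟨b, lt_of_not_ge fun hba => hb (lt_of_le_of_lt (Subtype.coe_le_coe.2 hba) hy)⟩⟩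
  obtain ⟨s, hs, hcof⟩ := exists_strictMono_isCofinal_range (C := c) rfl
  refine ⟨_, Order.aleph0_le_cof (α := c), fun α => s α, fun α β h => hs h, fun ⟨x, hx⟩ => ?_⟩
  obtain ⟨a, ha⟩ := hub' x
  obtain ⟨_, ⟨α, rfl⟩, hα⟩ := hcof a
  exact ha (lt_of_le_of_lt (Subtype.coe_le_coe.2 hα) (hx α))

theorem succ_le_towerNumber {X : Type u} [Nonempty X] {r : X → X → Prop} [IsStrictOrder X r]
    (hr : ∀ x, ∃ y, r x y) {lam : Cardinal.{u}}
    (h : ∀ κ : Cardinal.{u}, ℵ₀ ≤ κ → κ ≤ lam → ∀ f : κ.ord.ToType → X,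
      (∀ α β, α < β → r (f α) (f β)) → ∃ x, ∀ α, r (f α) x) :
    Order.succ lam ≤ towerNumber r := by
  refine le_csInf (exists_unbounded_tower r hr) ?_
  rintro κ ⟨hκ, f, hf, hno⟩
  exact Order.succ_le_of_lt (not_le.1 fun hle => hno (h κ hκ hle f hf))

end CofinalSequence

section InternalBounds

variable {I : Type*} {D : Filter I}

/-- Every bounding problem for the directed set `J` which is monotone modulo `D` has a solution
modulo `D`. For suitable `J`, this is the form of saturation of reduced powers modulo `D` which
fills cuts and bounds branches. -/
def HasInternalBounds (D : Filter I) (J : Type*) [Preorder J] : Prop :=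
  ∀ P : BoundingProblem I J, P.le = (· ≤ ·) → P.IsMonotone D → P.IsBounded D

/-- The problem of filling the cut between the increasing sequence `f` and the decreasing sequence
`g` modulo a filter: the interval `[f k.1 i, g k.2 i]` should be a nonempty subset of the interval
`[f j.1 i, g j.2 i]`, unless the latter is empty. -/
def cutProblem {A B M : Type*} [LinearOrder A] [LinearOrder B] [Preorder M] (f : A → I → M)
    (g : B → I → M) : BoundingProblem I (A × B) where
  le := (· ≤ ·)
  rel i j k := f j.1 i ≤ g j.2 i → f k.1 i ≤ g k.2 i ∧ f j.1 i ≤ f k.1 i ∧ g k.2 i ≤ g j.2 i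
  directed j k := ⟨j ⊔ k, le_sup_left, le_sup_right⟩
  refl _ _ h := ⟨h, le_rfl, le_rfl⟩
  trans hjk hkl h :=
    let ⟨hk, hfjk, hgkj⟩ := hjk h
    let ⟨hl, hfkl, hglk⟩ := hkl hk
    ⟨hl, hfjk.trans hfkl, hglk.trans hgkj⟩

theorem HasInternalBounds.exists_between {A B M : Type*} [LinearOrder A] [LinearOrder B]
    [Preorder M] (hD : HasInternalBounds D (A × B)) {f : A → I → M} {g : B → I → M}
    (hf : ∀ a b, a ≤ b → f a ≤ᶠ[D] f b) (hg : ∀ a b, a ≤ b → g b ≤ᶠ[D] g a)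
    (hfg : ∀ a b, f a ≤ᶠ[D] g b) : ∃ c : I → M, ∀ a b, f a ≤ᶠ[D] c ∧ c ≤ᶠ[D] g b := by
  obtain ⟨h, hh⟩ := hD (cutProblem f g) rfl fun j k hjk => by
    filter_upwards [hfg k.1 k.2, hf _ _ hjk.1, hg _ _ hjk.2] with i h₁ h₂ h₃ _
    exact ⟨h₁, h₂, h₃⟩
  have hc : ∀ a b, ∀ᶠ i in D, f a i ≤ f (h i).1 i ∧ f (h i).1 i ≤ g b i := fun a b => by
    filter_upwards [hh (a, b), hfg a b] with i hi hab
    exact ⟨(hi hab).2.1, (hi hab).1.trans (hi hab).2.2⟩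
  exact ⟨fun i => f (h i).1 i, fun a b => eventually_and.1 (hc a b)⟩

theorem HasInternalBounds.not_hasPreCut {I : Type u} {D : Filter I} {κ₁ κ₂ : Cardinal.{u}}
    (hD : HasInternalBounds D (κ₁.ord.ToType × κ₂.ord.ToType)) (hκ₁ : κ₁ ≠ 0) (hκ₂ : κ₂ ≠ 0)
    (M : Type v) [PartialOrder M] :
    ¬ HasPreCut (D.Germ M) (lift.{v} κ₁) (lift.{v} κ₂) := by
  classical
  rintro ⟨C₁, C₂, hC, h₁, h₂⟩
  let _ : LinearOrder C₁ := (hC.chain.mono subset_union_left).linearOrder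
  let _ : LinearOrder C₂ := (hC.chain.mono subset_union_right).linearOrder
  obtain ⟨s₁, hs₁, hcof₁⟩ := exists_strictMono_isCofinal_range (C := C₁) (κ := κ₁)
    (by rw [h₁, lift_lift, lift_umax.{u, v}])
  obtain ⟨s₂, hs₂, hcof₂⟩ := exists_strictMono_isCofinal_range (C := C₂ᵒᵈ) (κ := κ₂)
    (by rw [h₂, lift_lift, lift_umax.{u, v}])
  choose f hf using fun a => Quotient.exists_rep (s₁ a : D.Germ M)
  choose g hg using fun b => Quotient.exists_rep ((OrderDual.ofDual (s₂ b) : C₂) : D.Germ M)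
  have hle : ∀ {p q : I → M} {x y : D.Germ M}, (p : D.Germ M) = x → (q : D.Germ M) = y →
    (p ≤ᶠ[D] q ↔ x ≤ y) := by
    rintro p q _ _ rfl rfl
    exact Filter.Germ.coe_le.symm
  obtain ⟨c, hc⟩ := hD.exists_between (f := f) (g := g)
    (fun a b hab => (hle (hf a) (hf b)).2 (hs₁.monotone hab))
    (fun a b hab => (hle (hg b) (hg a)).2 (hs₂.monotone hab))
    (fun a b => (hle (hf a) (hg b)).2 (hC.le _ (s₁ a).2 _ (OrderDual.ofDual (s₂ b)).2))
  have : Nonempty κ₁.ord.ToType := by simpa using hκ₁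
  have : Nonempty κ₂.ord.ToType := by simpa using hκ₂
  refine hC.unfilled ⟨(c : D.Germ M), fun x hx => ?_, fun y hy => ?_⟩
  · obtain ⟨_, ⟨a, rfl⟩, ha⟩ := hcof₁ ⟨x, hx⟩
    exact le_trans (show x ≤ s₁ a from ha) ((hle (hf a) rfl).1 (hc a (Classical.arbitrary _)).1)
  · obtain ⟨_, ⟨b, rfl⟩, hb⟩ := hcof₂ (OrderDual.toDual ⟨y, hy⟩)
    exact le_trans ((hle rfl (hg b)).1 (hc (Classical.arbitrary _) b).2)
      (show ((OrderDual.ofDual (s₂ b) : C₂) : D.Germ M) ≤ y from hb)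

end InternalBounds

section Cut

/-- The filter of the sets which contain an end segment of `Θ₁`: it approaches the cut between `Θ₁`
and `Θ₂ᵒᵈ` from below. -/
def cutBelow (Θ₁ Θ₂ : Type*) [Preorder Θ₁] : Filter (Θ₁ ⊕ₗ Θ₂ᵒᵈ) :=
  atTop.map fun ξ => Sum.inlₗ ξ

/-- The filter of the sets which contain an initial segment of `Θ₂ᵒᵈ`: it approaches the cut between
`Θ₁` and `Θ₂ᵒᵈ` from above. -/
def cutAbove (Θ₁ Θ₂ : Type*) [Preorder Θ₂] : Filter (Θ₁ ⊕ₗ Θ₂ᵒᵈ) :=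
  atTop.map fun ζ => Sum.inrₗ (OrderDual.toDual ζ)

variable {Θ₁ Θ₂ : Type*} [LinearOrder Θ₁] [LinearOrder Θ₂]

instance neBot_cutBelow [Nonempty Θ₁] : (cutBelow Θ₁ Θ₂).NeBot := map_neBot

instance neBot_cutAbove [Nonempty Θ₂] : (cutAbove Θ₁ Θ₂).NeBot := map_neBot

theorem eventually_cutBelow_sup_cutAbove [NoMaxOrder Θ₁] [NoMaxOrder Θ₂] (w : Θ₁ ⊕ₗ Θ₂ᵒᵈ) :
    (∀ᶠ v in cutBelow Θ₁ Θ₂ ⊔ cutAbove Θ₁ Θ₂, w < v) ∨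
      ∀ᶠ v in cutBelow Θ₁ Θ₂ ⊔ cutAbove Θ₁ Θ₂, v < w := by
  simp only [eventually_sup, cutBelow, cutAbove, eventually_map]
  obtain ⟨ξ | ζ, rfl⟩ := toLex.surjective w
  · exact .inl ⟨(eventually_gt_atTop ξ).mono fun _ => Sum.Lex.inl_lt_inl_iff.2,
      .of_forall fun ζ => Sum.Lex.inl_lt_inr ξ (OrderDual.toDual ζ)⟩
  · exact .inr ⟨.of_forall fun ξ => Sum.Lex.inl_lt_inr ξ ζ,
      (eventually_gt_atTop (OrderDual.ofDual ζ)).mono fun _ h =>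
        Sum.Lex.inr_lt_inr_iff.2 (OrderDual.toDual_lt_toDual.2 h)⟩

theorem hasPreCut_of_strictMono {P : Type w} [PartialOrder P] {Θ₁ Θ₂ : Type u} [LinearOrder Θ₁]
    [LinearOrder Θ₂] {F : Θ₁ ⊕ₗ Θ₂ᵒᵈ → P} (hF : StrictMono F)
    (hno : ¬ ∃ c, (∀ ξ, F (Sum.inlₗ ξ) ≤ c) ∧ ∀ ζ, c ≤ F (Sum.inrₗ ζ)) {κ₁ κ₂ : Cardinal.{w}}
    (h₁ : lift.{w} (Order.cof Θ₁) = lift.{u} κ₁) (h₂ : lift.{w} (Order.cof Θ₂) = lift.{u} κ₂) :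
    HasPreCut P κ₁ κ₂ := by
  have hF₁ : StrictMono fun ξ => F (Sum.inlₗ ξ) := fun _ _ h => hF (Sum.Lex.inl_lt_inl_iff.2 h)
  have hF₂ : StrictMono fun ζ => F (Sum.inrₗ ζ) := fun _ _ h => hF (Sum.Lex.inr_lt_inr_iff.2 h)
  refine ⟨range fun ξ => F (Sum.inlₗ ξ), range fun ζ => F (Sum.inrₗ ζ), ⟨?_, ?_, ?_⟩, ?_, ?_⟩
  · refine hF.monotone.isChain_range.mono (union_subset ?_ ?_) <;> exact range_subset_iff.2 fun _ =>
      mem_range_self _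
  · rintro _ ⟨ξ, rfl⟩ _ ⟨ζ, rfl⟩
    exact (hF (Sum.Lex.inl_lt_inr ξ ζ)).le
  · simpa using hno
  · exact lift_injective.{u} <| (StrictMono.orderIso _ hF₁).lift_cof_congr.symm.trans h₁
  · exact lift_injective.{u} <|
      ((OrderIso.dualDual _).trans (StrictMono.orderIso _ hF₂).dual).lift_cof_congr.symm.trans h₂

theorem IsGenericChain.not_exists_between {I W M : Type*} [LinearOrder W] {L₁ L₂ : Filter W}
    {D : Filter I} {q : I → W → ℚ} (hq : IsGenericChain D L₁ L₂ q) [PartialOrder M] (e : ℚ ↪o M)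
    (c : I → M) : ¬ ((∀ᶠ v in L₁, ∀ᶠ i in D, e (q i v) ≤ c i) ∧
      ∀ᶠ w in L₂, ∀ᶠ i in D, c i ≤ e (q i w)) := by
  rintro ⟨h₁, h₂⟩
  obtain ⟨v, w, i, ⟨hv, hw⟩, hlt⟩ := hq.exists_lt h₁ h₂
  exact (e.lt_iff_lt.2 hlt).not_ge (le_trans hv hw)

theorem IsGenericChain.strictMono_germ {I W M : Type*} [LinearOrder W] {L₁ L₂ : Filter W}
    {D : Filter I} {q : I → W → ℚ} (hq : IsGenericChain D L₁ L₂ q) [PartialOrder M] (e : ℚ ↪o M) :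
    StrictMono fun w => ((fun i => e (q i w) : I → M) : D.Germ M) := by
  have := hq.neBot
  intro v w h
  have hlt := hq.eventually_lt h
  refine lt_iff_le_not_ge.2 ⟨Filter.Germ.coe_le.2 ?_, fun hle => ?_⟩
  · exact hlt.mono fun i hi => e.monotone hi.le
  · obtain ⟨i, hle, hlt⟩ := ((Filter.Germ.coe_le.1 hle).and hlt).exists
    exact (e.lt_iff_lt.2 hlt).not_ge hle

theorem IsGenericChain.hasPreCut {I : Type u} {Θ₁ Θ₂ : Type u} [LinearOrder Θ₁] [LinearOrder Θ₂]
    {D : Filter I} {q : I → Θ₁ ⊕ₗ Θ₂ᵒᵈ → ℚ}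
    (hq : IsGenericChain D (cutBelow Θ₁ Θ₂) (cutAbove Θ₁ Θ₂) q) {M : Type v} [PartialOrder M]
    (e : ℚ ↪o M) :
    HasPreCut (D.Germ M) (lift.{v} (Order.cof Θ₁)) (lift.{v} (Order.cof Θ₂)) := by
  refine hasPreCut_of_strictMono (hq.strictMono_germ e) ?_ ?_ ?_
  · rintro ⟨c, hc₁, hc₂⟩
    obtain ⟨c, rfl⟩ := Quotient.exists_rep c
    exact hq.not_exists_between e c
      ⟨eventually_map.2 (.of_forall fun ξ => Filter.Germ.coe_le.1 (hc₁ ξ)),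
        eventually_map.2 (.of_forall fun ζ => Filter.Germ.coe_le.1 (hc₂ (OrderDual.toDual ζ)))⟩
  · rw [lift_lift, lift_umax.{u, v}]
  · rw [lift_lift, lift_umax.{u, v}]

end Cut

section Tree

theorem BinPrefix.trans_strict {s t v : List Bool} (h₁ : BinPrefix s t)
    (h₂ : BinStrictPrefix t v) : BinStrictPrefix s v :=
  ⟨List.IsPrefix.trans h₁ h₂.1, fun h => h₂.2 (h₂.1.eq_of_length_le (h ▸ h₁).length_le)⟩

theorem binStrictPrefix_append (s : List Bool) : BinStrictPrefix s (s ++ [true]) :=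
  ⟨List.prefix_append _ _, by simp⟩

variable {I : Type u} {D : Filter I}

/-- The problem of bounding the increasing sequence `g` in the tree of binary sequences. -/
def branchProblem {A : Type*} [LinearOrder A] (g : A → I → List Bool) : BoundingProblem I A where
  le := (· ≤ ·)
  rel i a b := BinPrefix (g a i) (g b i)
  directed a b := ⟨a ⊔ b, le_sup_left, le_sup_right⟩
  refl _ _ := List.prefix_refl _
  trans := List.IsPrefix.trans

theorem HasInternalBounds.exists_binStrictPrefix {A : Type*} [LinearOrder A]
    (hD : HasInternalBounds D A) {g : A → I → List Bool}
    (hg : ∀ a b, a ≤ b → ∀ᶠ i in D, BinPrefix (g a i) (g b i)) :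
    ∃ x : I → List Bool, ∀ a, ∀ᶠ i in D, BinStrictPrefix (g a i) (x i) := by
  obtain ⟨h, hh⟩ := hD (branchProblem g) rfl hg
  exact ⟨fun i => g (h i) i ++ [true], fun a => (hh a).mono fun i hi =>
    BinPrefix.trans_strict hi (binStrictPrefix_append _)⟩

theorem HasInternalBounds.exists_treeLT {κ : Cardinal.{u}}
    (hD : HasInternalBounds D κ.ord.cof.ord.ToType) (f : κ.ord.ToType → D.Germ (List Bool))
    (hf : ∀ α β, α < β → Filter.Germ.LiftRel BinPrefix (f α) (f β)) :
    ∃ x, ∀ α, treeLT D (f α) x := by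
  obtain ⟨s, hs, hcof⟩ := exists_strictMono_isCofinal_range (C := κ.ord.ToType) (κ := κ.ord.cof)
    (by rw [Ordinal.cof_toType])
  choose g hg using fun α => Quotient.exists_rep (f α)
  have hle : ∀ α β, α ≤ β → ∀ᶠ i in D, BinPrefix (g α i) (g β i) := by
    intro α β h
    rcases h.lt_or_eq with h | rfl
    · have hlt := hf α β h
      rwa [← hg α, ← hg β] at hlt
    · exact .of_forall fun i => List.prefix_refl _
  obtain ⟨x, hx⟩ := hD.exists_binStrictPrefix (g := fun a => g (s a))
    fun a b hab => hle _ _ (hs.monotone hab)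
  refine ⟨(x : D.Germ (List Bool)), fun α => ?_⟩
  obtain ⟨_, ⟨a, rfl⟩, ha⟩ := hcof α
  rw [← hg α]
  exact ((hle _ _ ha).and (hx a)).mono fun i hi => hi.1.trans_strict hi.2

theorem treeLT.treePosetLT [D.NeBot] {x y : D.Germ (List Bool)} (h : treeLT D x y) :
    treePosetLT D x y := by
  induction x, y using Filter.Germ.inductionOn₂ with | _ x y
  have hlt : ∀ᶠ i in D, BinStrictPrefix (x i) (y i) := h
  refine ⟨hlt.mono fun i hi => hi.1, fun he => ?_⟩
  obtain ⟨i, hlt, heq⟩ := (hlt.and (Filter.Germ.coe_eq.1 he)).exists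
  exact hlt.2 heq

instance isStrictOrder_treeLT [D.NeBot] : IsStrictOrder (D.Germ (List Bool)) (treeLT D) where
  irrefl x h := h.treePosetLT.2 rfl
  trans x y z := by
    induction x, y, z using Filter.Germ.inductionOn₃ with | _ x y z
    exact fun hxy hyz => (Filter.Eventually.and hxy hyz).mono fun i hi =>
      BinPrefix.trans_strict hi.1.1 hi.2

instance isStrictOrder_treePosetLT : IsStrictOrder (D.Germ (List Bool)) (treePosetLT D) where
  irrefl x h := h.2 rfl
  trans x y z := by
    induction x, y, z using Filter.Germ.inductionOn₃ with | _ x y z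
    rintro ⟨hxy, hne⟩ ⟨hyz, -⟩
    refine ⟨(Filter.Eventually.and hxy hyz).mono fun i hi => List.IsPrefix.trans hi.1 hi.2,
      fun he => hne (Filter.Germ.coe_eq.2 ?_)⟩
    filter_upwards [hxy, hyz, Filter.Germ.coe_eq.1 he] with i hxy hyz hxz
    exact hxy.eq_of_length_le (hxz ▸ hyz).length_le

theorem exists_treeLT (x : D.Germ (List Bool)) : ∃ y, treeLT D x y := by
  induction x using Filter.Germ.inductionOn with | _ x
  exact ⟨((fun i => x i ++ [true] : I → List Bool) : D.Germ (List Bool)),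
    .of_forall fun i => binStrictPrefix_append _⟩

theorem succ_le_towerNumber_tree [D.NeBot] {lam : Cardinal.{u}}
    (hD : ∀ κ : Cardinal.{u}, κ.IsRegular → κ ≤ lam → HasInternalBounds D κ.ord.ToType) :
    Order.succ lam ≤ towerNumber (treeLT D) ∧ Order.succ lam ≤ towerNumber (treePosetLT D) := by
  have : Nonempty (D.Germ (List Bool)) := ⟨((fun _ => [] : I → List Bool) : D.Germ (List Bool))⟩
  have hbound : ∀ κ : Cardinal.{u}, ℵ₀ ≤ κ → κ ≤ lam →
      HasInternalBounds D κ.ord.cof.ord.ToType := fun κ hκ hle =>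
    hD _ (isRegular_cof (isSuccLimit_ord hκ)) ((Ordinal.cof_ord_le κ).trans hle)
  constructor
  · exact succ_le_towerNumber exists_treeLT fun κ hκ hle f hf =>
      (hbound κ hκ hle).exists_treeLT f fun α β h => (hf α β h).treePosetLT.1
  · refine succ_le_towerNumber (fun x => (exists_treeLT x).imp fun _ => treeLT.treePosetLT)
      fun κ hκ hle f hf => ?_
    exact ((hbound κ hκ hle).exists_treeLT f fun α β h => (hf α β h).1).imp fun _ hx α =>
      (hx α).treePosetLT

end Tree

section RegularPair

theorem countableInterFilter_atTop_of_isRegular {θ : Cardinal.{u}} (hθ : θ.IsRegular)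
    (h : ℵ₀ < θ) : CountableInterFilter (atTop : Filter θ.ord.ToType) :=
  have : Nonempty θ.ord.ToType := by simpa using hθ.ne_zero
  CardinalInterFilter.toCountableInterFilter (c := Order.cof θ.ord.ToType) atTop
    (by rwa [Ordinal.cof_toType, hθ.cof_ord])

theorem exists_filter_of_isRegular (I : Type u) {θ₁ θ₂ : Cardinal.{u}}
    (hθ₁ : θ₁.IsRegular) (hθ₂ : θ₂.IsRegular) (hθ₁I : θ₁ ≤ #I) (hθ₂I : θ₂ ≤ #I)
    (hθ : ℵ₀ < θ₁ + θ₂) : ∃ D : Filter I, IsRegularFilter D ∧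
      (∃ q, IsGenericChain D (cutBelow θ₁.ord.ToType θ₂.ord.ToType)
        (cutAbove θ₁.ord.ToType θ₂.ord.ToType) q) ∧
      ∀ {J : Type u} [Nonempty J] [Preorder J], #J ≤ #I →
        (∃ θ ∈ ({θ₁, θ₂} : Set Cardinal.{u}),
          FrequentlyBounds (atTop : Filter θ.ord.ToType) ((· ≤ ·) : J → J → Prop)) →
        HasInternalBounds D J := by
  have hI : ℵ₀ ≤ #I := hθ₁.aleph0_le.trans hθ₁I
  have : Infinite I := infinite_iff.2 hI
  have : NoMaxOrder θ₁.ord.ToType := Cardinal.noMaxOrder hθ₁.aleph0_le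
  have : NoMaxOrder θ₂.ord.ToType := Cardinal.noMaxOrder hθ₂.aleph0_le
  have : Nonempty θ₁.ord.ToType := by simpa using hθ₁.ne_zero
  have : Nonempty θ₂.ord.ToType := by simpa using hθ₂.ne_zero
  have hω : CountableInterFilter (cutBelow θ₁.ord.ToType θ₂.ord.ToType) ∨
      CountableInterFilter (cutAbove θ₁.ord.ToType θ₂.ord.ToType) := by
    rw [add_eq_max hθ₁.aleph0_le, lt_max_iff] at hθ
    refine hθ.imp (fun h => ?_) fun h => ?_
    · have := countableInterFilter_atTop_of_isRegular hθ₁ h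
      exact inferInstanceAs (CountableInterFilter (map _ _))
    · have := countableInterFilter_atTop_of_isRegular hθ₂ h
      exact inferInstanceAs (CountableInterFilter (map _ _))
  have hW : #(θ₁.ord.ToType ⊕ₗ (θ₂.ord.ToType)ᵒᵈ) ≤ #I := by
    rw [mk_congr (ofLex : _ ≃ θ₁.ord.ToType ⊕ (θ₂.ord.ToType)ᵒᵈ), mk_sum, lift_id, lift_id,
      mk_congr (OrderDual.ofDual : (θ₂.ord.ToType)ᵒᵈ ≃ _), mk_ord_toType, mk_ord_toType]
    exact add_le_of_le hI hθ₁I hθ₂I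
  obtain ⟨D, hreg, hq, hD⟩ := exists_regular_filter hW hω eventually_cutBelow_sup_cutAbove
  refine ⟨D, hreg, hq, fun {J} _ _ hJ hθJ P hP hmono => hD P hJ ?_ hmono⟩
  obtain ⟨θ, rfl | rfl, h⟩ := hθJ
  · exact .inl (hP ▸ h.map _)
  · exact .inr (hP ▸ h.map _)

end RegularPair

theorem theorem4_general (I : Type u) {θ₁ θ₂ : Cardinal.{u}} (hθ₁ : θ₁.IsRegular)
    (hθ₂ : θ₂.IsRegular) (hθ₁I : θ₁ ≤ #I) (hθ₂I : θ₂ ≤ #I) (hθ : ℵ₀ < θ₁ + θ₂) :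
    ∃ D : Filter I, D.NeBot ∧ IsRegularFilter D ∧
      (∀ (M : Type v) [PartialOrder M],
        (Nonempty (ℚ ↪o M) → HasPreCut (D.Germ M) (lift.{v} θ₁) (lift.{v} θ₂)) ∧
        ∀ κ₁ κ₂ : Cardinal.{u}, κ₁.IsRegular → κ₂.IsRegular → κ₁ ≤ #I → κ₂ ≤ #I →
          ¬ ({θ₁, θ₂} : Set Cardinal.{u}) ⊆ {κ₁, κ₂} →
          ¬ HasPreCut (D.Germ M) (lift.{v} κ₁) (lift.{v} κ₂)) ∧
      (θ₁ ≠ θ₂ →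
        Order.succ #I ≤ towerNumber (treeLT D) ∧
        Order.succ #I ≤ towerNumber (treePosetLT D)) := by
  obtain ⟨D, hreg, ⟨q, hq⟩, hD⟩ := exists_filter_of_isRegular I hθ₁ hθ₂ hθ₁I hθ₂I hθ
  have hθs : ∀ θ ∈ ({θ₁, θ₂} : Set Cardinal.{u}), θ.IsRegular := by simp [hθ₁, hθ₂]
  have := hq.neBot
  refine ⟨D, hq.neBot, hreg, fun M _ => ⟨fun ⟨e⟩ => ?_, fun κ₁ κ₂ hκ₁ hκ₂ hκ₁I hκ₂I hκ => ?_⟩,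
    fun hne => succ_le_towerNumber_tree fun κ hκ hκI => ?_⟩
  · simpa only [Ordinal.cof_toType, hθ₁.cof_ord, hθ₂.cof_ord] using hq.hasPreCut e
  · obtain ⟨θ, hθ, hθκ⟩ := Set.not_subset.1 hκ
    have : Nonempty κ₁.ord.ToType := by simpa using hκ₁.ne_zero
    have : Nonempty κ₂.ord.ToType := by simpa using hκ₂.ne_zero
    have hJ : #(κ₁.ord.ToType × κ₂.ord.ToType) ≤ #I := by
      rw [mk_prod, lift_id, lift_id, mk_ord_toType, mk_ord_toType]
      exact mul_le_of_le (hθ₁.aleph0_le.trans hθ₁I) hκ₁I hκ₂I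
    have hbounds : HasInternalBounds D (κ₁.ord.ToType × κ₂.ord.ToType) := hD hJ ⟨θ, hθ,
      (frequentlyBounds_atTop (hθs θ hθ) hκ₁ fun h => hθκ (.inl h)).prod
        (frequentlyBounds_atTop (hθs θ hθ) hκ₂ fun h => hθκ (.inr h))⟩
    exact hbounds.not_hasPreCut hκ₁.ne_zero hκ₂.ne_zero M
  · have : Nonempty κ.ord.ToType := by simpa using hκ.ne_zero
    obtain ⟨θ, hθ, hθκ⟩ : ∃ θ ∈ ({θ₁, θ₂} : Set Cardinal.{u}), θ ≠ κ := by
      by_contra! h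
      exact hne ((h θ₁ (.inl rfl)).trans (h θ₂ (.inr rfl)).symm)
    exact hD (by rwa [mk_ord_toType]) ⟨θ, hθ, frequentlyBounds_atTop (hθs θ hθ) hκ hθκ⟩

theorem theorem4 (I : Type u) (lam θ₁ θ₂ : Cardinal.{u}) (hI : #I = lam)
    (hθ₁ : θ₁.IsRegular) (hθ₂ : θ₂.IsRegular) (hθ₁lam : θ₁ ≤ lam) (hθ₂lam : θ₂ ≤ lam)
    (hθ : ℵ₀ < θ₁ + θ₂) :
    ∃ D : Filter I, D.NeBot ∧ IsRegularFilter D ∧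
      (∀ (M : Type v) [LinearOrder M] [DenselyOrdered M] [Nontrivial M],
        HasPreCut (D.Germ M) (Cardinal.lift.{v} θ₁) (Cardinal.lift.{v} θ₂) ∧
        ∀ κ₁ κ₂ : Cardinal.{u}, κ₁.IsRegular → κ₂.IsRegular → κ₁ ≤ lam → κ₂ ≤ lam →
          ¬ ({θ₁, θ₂} : Set Cardinal.{u}) ⊆ {κ₁, κ₂} →
          ¬ HasPreCut (D.Germ M) (Cardinal.lift.{v} κ₁) (Cardinal.lift.{v} κ₂)) ∧
      (θ₁ ≠ θ₂ →
        Order.succ lam ≤ towerNumber (treeLT D) ∧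
        Order.succ lam ≤ towerNumber (treePosetLT D)) := by
  subst hI
  obtain ⟨D, hD, hreg, hcut, htower⟩ := theorem4_general.{u, v} I hθ₁ hθ₂ hθ₁lam hθ₂lam hθ
  exact ⟨D, hD, hreg, fun M _ _ _ =>
    (hcut M).imp_left fun h => h (Order.embedding_from_countable_to_dense ℚ M), htower⟩
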